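/- Let $l,d\in\mathbb{N}$ and let $X=(X_t)_{t\in\mathbb{R}^l}$ be an $\mathbb{R}^d$-valued random field on a probability space $(\Omega,\mathcal F,\mathbb P)$ that is strictly stationary (all finite-dimensional distributions are invariant under translations of $\mathbb{R}^l$) and infinitely divisible (all finite-dimensional distributions are infinitely divisible). Let $\mathcal T$ be the set of sequences $(t_n)_{n\in\mathbb{N}}$ in $\mathbb{R}^l$ with $\|t_n\|_\infty\to\infty$. The field $X$ is called mixing if for all $m\in\mathbb{N}$, $s_1,\dots,s_m,p_1,\dots,p_m\in\mathbb{R}^l$, $\theta_1^{(1)},\dots,\theta_1^{(m)},\theta_2^{(1)},\dots,\theta_2^{(m)}\in\mathbb{R}^d$ and all $(t_n)\in\mathcal T$, $$\lim_{n\to\infty}\mathbb{E}\Big[e^{i\sum_{j}\langle\theta_1^{(j)},X_{s_j}\rangle+i\sum_{j}\langle\theta_2^{(j)},X_{p_j+t_n}\rangle}\Big]=\mathbb{E}\Big[e^{i\sum_{j}\langle\theta_1^{(j)},X_{s_j}\rangle}\Big]\,\mathbb{E}\Big[e^{i\sum_{j}\langle\theta_2^{(j)},X_{p_j}\rangle}\Big].$$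 For $t\in\mathbb{R}^l$ let $Q_{0t}$ be the Lévy measure, on $\mathbb{R}^d\times\mathbb{R}^d=\mathbb{R}^{2d}$, and $A_t$ the $2d\times 2d$ Gaussian covariance matrix in the Lévy–Khintchine triplet of the law of $(X_0,X_t)$; let $\Sigma(t)$ be the $d\times d$ off-diagonal block of $A_t$, i.e. the cross-covariance matrix of the two components of the Gaussian part of $(X_0,X_t)$. Then $X$ is mixing if and only if for every sequence $(t_n)_{n\in\mathbb{N}}\in\mathcal T$ both of the following hold: (MM1) $\Sigma(t_n)\to 0$ as $n\to\infty$; (MM2') for every $\delta>0$, $\displaystyle\lim_{n\to\infty}Q_{0t_n}\big(\{(x,y)\in\mathbb{R}^d\times\mathbb{R}^d:\|x\|\cdot\|y\|>\delta\}\big)=0$. -/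

import Mathlib

open MeasureTheory Filter Topology
open scoped RealInnerProductSpace

namespace IDField

/-- A measure `μ` is an infinitely divisible distribution: for every `n ≥ 1` it is the law of the
sum of `n` i.i.d. random variables. -/
def IsInfinitelyDivisible {E : Type*} [AddCommMonoid E] [MeasurableSpace E]
    (μ : Measure E) : Prop :=
  ∀ n : ℕ, 1 ≤ n → ∃ ρ : Measure E, IsProbabilityMeasure ρ ∧
    (Measure.pi (fun _ : Fin n => ρ)).map (fun x => ∑ i, x i) = μ

/-- The data of a characteristic triplet on a real inner product space `E`. -/
structure Triplet (E : Type*) [NormedAddCommGroup E] [InnerProductSpace ℝ E]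
    [MeasurableSpace E] where
  /-- the drift vector -/
  drift : E
  /-- the covariance operator of the Gaussian part -/
  gaussianCov : E →L[ℝ] E
  /-- the Lévy measure -/
  levyMeasure : Measure E

section Triplet

variable {E : Type*} [NormedAddCommGroup E] [InnerProductSpace ℝ E] [MeasurableSpace E]

/-- The Lévy–Khintchine exponent of a triplet `(γ, A, ν)`, with truncation function
`𝟙_{‖x‖ ≤ 1}`:
`i⟨γ,θ⟩ - ⟨θ,Aθ⟩/2 + ∫ (exp(i⟨θ,x⟩) - 1 - i⟨θ,x⟩ 𝟙_{‖x‖ ≤ 1}) ν(dx)`. -/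
noncomputable def Triplet.exponent (T : Triplet E) (θ : E) : ℂ :=
  Complex.I * (⟪T.drift, θ⟫ : ℝ) - ((⟪θ, T.gaussianCov θ⟫ / 2 : ℝ) : ℂ)
    + ∫ x, (Complex.exp (Complex.I * (⟪θ, x⟫ : ℝ)) - 1
        - Complex.I * (⟪θ, x⟫ : ℝ) *
          (Metric.closedBall (0 : E) 1).indicator (fun _ => (1 : ℂ)) x) ∂T.levyMeasure

/-- `T` is the characteristic (Lévy–Khintchine) triplet of the distribution `μ`: the Gaussian
covariance operator is symmetric and nonnegative, `ν {0} = 0`, `∫ min(1, ‖x‖²) dν < ∞`, and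
the characteristic function of `μ` is `exp` of the Lévy–Khintchine exponent of `T`. -/
structure Triplet.IsTripletOf (T : Triplet E) (μ : Measure E) : Prop where
  gaussianCov_pos : T.gaussianCov.IsPositive
  levyMeasure_zero : T.levyMeasure {0} = 0
  integrable_levyMeasure : Integrable (fun x : E => min 1 (‖x‖ ^ 2)) T.levyMeasure
  charFun_eq : ∀ θ : E, charFun μ θ = Complex.exp (T.exponent θ)

open Classical in
/-- The characteristic triplet of a distribution (for an infinitely divisible distribution on a
Euclidean space it exists and is unique; the value `(0, 0, 0)` is used when there is none). -/
noncomputable def triplet (μ : Measure E) : Triplet E :=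
  if h : ∃ T : Triplet E, T.IsTripletOf μ then h.choose else ⟨0, 0, 0⟩

end Triplet

section Field

variable {Ω : Type*} [MeasurableSpace Ω] {l d : ℕ}

/-- The field is strictly stationary: all finite-dimensional distributions are invariant under
translations of the index set. -/
def IsStrictlyStationary (P : Measure Ω)
    (X : (Fin l → ℝ) → Ω → EuclideanSpace ℝ (Fin d)) : Prop :=
  ∀ (m : ℕ) (s : Fin m → Fin l → ℝ) (h : Fin l → ℝ),
    P.map (fun ω (i : Fin m) => X (s i + h) ω) = P.map (fun ω (i : Fin m) => X (s i) ω)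

/-- The field is infinitely divisible: all its finite-dimensional distributions are. -/
def IsInfinitelyDivisibleField (P : Measure Ω)
    (X : (Fin l → ℝ) → Ω → EuclideanSpace ℝ (Fin d)) : Prop :=
  ∀ (m : ℕ) (s : Fin m → Fin l → ℝ),
    IsInfinitelyDivisible (P.map (fun ω (i : Fin m) => X (s i) ω))

/-- The sequences `(tₙ)` in `ℝˡ` with `‖tₙ‖_∞ → ∞` (the norm of `Fin l → ℝ` is the sup norm). -/
def EscapesToInfinity (t : ℕ → Fin l → ℝ) : Prop :=
  Tendsto (fun n => ‖t n‖) atTop atTop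

/-- The (stationary) field is mixing. -/
def IsMixing (P : Measure Ω)
    (X : (Fin l → ℝ) → Ω → EuclideanSpace ℝ (Fin d)) : Prop :=
  ∀ (m : ℕ) (s p : Fin m → Fin l → ℝ) (θ₁ θ₂ : Fin m → EuclideanSpace ℝ (Fin d))
    (t : ℕ → Fin l → ℝ), EscapesToInfinity t →
    Tendsto
      (fun n => ∫ ω, Complex.exp (Complex.I * ((∑ j, ⟪θ₁ j, X (s j) ω⟫ : ℝ) : ℂ)
          + Complex.I * ((∑ j, ⟪θ₂ j, X (p j + t n) ω⟫ : ℝ) : ℂ)) ∂P)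
      atTop
      (𝓝 ((∫ ω, Complex.exp (Complex.I * ((∑ j, ⟪θ₁ j, X (s j) ω⟫ : ℝ) : ℂ)) ∂P)
        * ∫ ω, Complex.exp (Complex.I * ((∑ j, ⟪θ₂ j, X (p j) ω⟫ : ℝ) : ℂ)) ∂P))

/-- The law of `(X₀, X_t)` on `ℝᵈ × ℝᵈ = ℝ²ᵈ`, with its Euclidean structure. -/
noncomputable def pairLaw (P : Measure Ω)
    (X : (Fin l → ℝ) → Ω → EuclideanSpace ℝ (Fin d)) (t : Fin l → ℝ) :
    Measure (WithLp 2 (EuclideanSpace ℝ (Fin d) × EuclideanSpace ℝ (Fin d))) :=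
  P.map (fun ω => WithLp.toLp 2 (X 0 ω, X t ω))

/-- `Σ(t)`: the `d × d` cross-covariance matrix of the Gaussian part of `(X₀, X_t)`, that is, the
off-diagonal block of the `2d × 2d` Gaussian covariance matrix; its `(j, k)` entry is the
covariance of the `j`-th coordinate of the first component and the `k`-th coordinate of the
second one. -/
noncomputable def gaussianCrossCov (P : Measure Ω)
    (X : (Fin l → ℝ) → Ω → EuclideanSpace ℝ (Fin d)) (t : Fin l → ℝ) :
    Matrix (Fin d) (Fin d) ℝ :=
  Matrix.of fun j k =>
    ⟪WithLp.toLp 2 (EuclideanSpace.single j (1 : ℝ), (0 : EuclideanSpace ℝ (Fin d))),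
      (triplet (pairLaw P X t)).gaussianCov
        (WithLp.toLp 2 ((0 : EuclideanSpace ℝ (Fin d)), EuclideanSpace.single k (1 : ℝ)))⟫

/-- `Q_{0t}`: the Lévy measure of the law of `(X₀, X_t)`. -/
noncomputable def pairLevyMeasure (P : Measure Ω)
    (X : (Fin l → ℝ) → Ω → EuclideanSpace ℝ (Fin d)) (t : Fin l → ℝ) :
    Measure (WithLp 2 (EuclideanSpace ℝ (Fin d) × EuclideanSpace ℝ (Fin d))) :=
  (triplet (pairLaw P X t)).levyMeasure

end Field

end IDField

/-!
For directions `u`, `v` in a Euclidean space and a distribution with characteristic triplet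
`(γ, A, ν)`, drift and truncation are linear in the argument of the Lévy–Khintchine exponent `ψ`, so
`ψ(u + v) - ψ(u) - ψ(v) = -⟪u, A v⟫ + ∫ (exp(i⟪u, x⟫) - 1) (exp(i⟪v, x⟫) - 1) ν(dx)`
(`Triplet.codifference`, `exponent_add`). Asymptotic independence of `X₀` and `X_{tₙ}` means that the
exponential of this quantity tends to `1`. It is compared with two other conditions: `⟪u, A v⟫ → 0`
together with the vanishing of `∫ min(1, |⟪u, x⟫|) min(1, |⟪v, x⟫|) ν(dx)` (`Triplet.crossMoment`),
and `⟪u, A v⟫ → 0` together with the vanishing of `ν {|⟪u, x⟫ ⟪v, x⟫| > δ}` for all `δ > 0`.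

Stationarity enters through the fact that the marginal distributions in the directions `u` and `v`
are fixed. No uniqueness of triplets is needed: the real part of `ψ` along a ray fixes both `⟪u, A u⟫`
(its quadratic growth rate) and the integrals of `1 - cos(c ⟪u, x⟫)`, and these control the truncated
second moments of `ν` in the direction `u` at every scale (`truncMoment_le`). Small jumps and large
jumps are thus uniformly negligible along the sequence, and what remains of the cross moment is
governed by `ν {|⟪u, x⟫ ⟪v, x⟫| > δ}` (`tendsto_crossMoment_of_measure`,
`tendsto_measure_of_crossMoment`) or by `∫ (1 - cos(c ⟪u, x⟫)) (1 - cos(c ⟪v, x⟫)) ν(dx)`, which is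
the half-sum of the real parts of the codifferences at `(c u, c v)` and `(c u, -c v)`
(`AsymptoticallyIndependent.tendsto_crossMoment`). The half-difference, divided by `c²` with `c`
large, gives `⟪u, A v⟫ → 0` (`AsymptoticallyIndependent.tendsto_gaussianCov`).

Since `⟪u, A v⟫` is bilinear and the cross moment is subadditive in each of `u` and `v`, asymptotic
independence of pairs passes to finite families of times (`tendsto_charFun_sum_add_sum`), which is
mixing.

The existence of characteristic triplets (`exists_isTripletOf`) is proved along the way. If `ρₙ` is
the `(n + 1)`-st convolution root of `μ`, then `(n + 1) (charFun ρₙ - 1)` converges to the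
distinguished logarithm of `charFun μ`, and the measures `‖x‖² / (1 + ‖x‖²) (n + 1) ρₙ(dx)` are tight
with bounded mass. They are transported to polar coordinates `(r, s)`, where the Lévy–Khintchine
kernel is continuous up to `r = 0`; a weak limit yields the Lévy measure from the part with
`r • s ≠ 0` and the Gaussian covariance from the part above the origin.
-/

set_option linter.unusedSectionVars false

namespace IDField

/-! ### Elementary inequalities -/

theorem norm_exp_I_mul_sub_one_le_min (y : ℝ) :
    ‖Complex.exp (Complex.I * y) - 1‖ ≤ 2 * min 1 |y| := by
  have h1 : ‖Complex.exp (Complex.I * y) - 1‖ ≤ |y| := Real.norm_exp_I_mul_ofReal_sub_one_le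
  have h2 : ‖Complex.exp (Complex.I * y) - 1‖ ≤ 2 := by
    refine (norm_sub_le _ _).trans ?_
    rw [mul_comm, Complex.norm_exp_ofReal_mul_I]
    norm_num
  rcases min_cases 1 |y| with ⟨h, h'⟩ | ⟨h, h'⟩ <;> rw [h] <;> linarith [abs_nonneg y]

theorem norm_exp_I_mul_sub_one_sub_le (y : ℝ) :
    ‖Complex.exp (Complex.I * y) - 1 - Complex.I * y‖ ≤ 3 * y ^ 2 := by
  rcases le_total |y| 1 with h | h
  · have := Complex.norm_exp_sub_one_sub_id_le (x := Complex.I * y) (by simpa using h)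
    simp only [norm_mul, Complex.norm_I, one_mul, Complex.norm_real, Real.norm_eq_abs,
      sq_abs] at this
    nlinarith [sq_nonneg y]
  · have h1 := norm_exp_I_mul_sub_one_le_min y
    have h2 : ‖Complex.I * (y : ℂ)‖ = |y| := by simp
    have h3 := norm_sub_le (Complex.exp (Complex.I * y) - 1) (Complex.I * y)
    have h4 : min 1 |y| ≤ 1 := min_le_left _ _
    nlinarith [sq_abs y]

theorem one_sub_cos_le_min (y : ℝ) : 1 - Real.cos y ≤ 2 * min 1 (y ^ 2) := by
  have h1 := Real.one_sub_sq_div_two_le_cos (x := y)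
  have h2 := Real.neg_one_le_cos y
  rcases min_cases 1 (y ^ 2) with ⟨h, h'⟩ | ⟨h, h'⟩ <;> rw [h] <;> nlinarith

theorem sq_le_mul_one_sub_cos {y : ℝ} (hy : |y| ≤ 3) : y ^ 2 ≤ 5 * (1 - Real.cos y) := by
  have h := Real.cos_le_one_sub_mul_cos_sq (hy.trans Real.pi_gt_three.le)
  have h1 : (1 / 5 : ℝ) ≤ 2 / Real.pi ^ 2 := by
    rw [div_le_div_iff₀ (by norm_num) (by positivity)]
    nlinarith [Real.pi_lt_d2, Real.pi_pos]
  nlinarith [sq_nonneg y]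

/-- The integral equals `1 - sin y / y`; the constant `15` comes from a quadratic lower bound of
`1 - cos` for `|y| ≤ 3` and from `|sin y / y| ≤ 1 / 3` otherwise. -/
theorem min_one_sq_le_integral_one_sub_cos (y : ℝ) :
    min 1 (y ^ 2) ≤ 15 * ∫ c in (0 : ℝ)..1, (1 - Real.cos (c * y)) := by
  rcases le_total |y| 3 with h | h
  · have h1 : ∫ c in (0 : ℝ)..1, c ^ 2 * (y ^ 2 / 5) ≤
        ∫ c in (0 : ℝ)..1, (1 - Real.cos (c * y)) := by
      refine intervalIntegral.integral_mono_on zero_le_one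
        (Continuous.intervalIntegrable (by fun_prop) _ _)
        (Continuous.intervalIntegrable (by fun_prop) _ _) fun c hc => ?_
      have hcy : |c * y| ≤ 3 := by
        rw [abs_mul, abs_of_nonneg hc.1]
        nlinarith [hc.2, abs_nonneg y, hc.1]
      nlinarith [sq_le_mul_one_sub_cos hcy]
    rw [intervalIntegral.integral_mul_const, integral_pow] at h1
    norm_num at h1
    have := min_le_right 1 (y ^ 2)
    linarith
  · have hy : y ≠ 0 := by
      rintro rfl
      norm_num at h
    have h1 : ∫ c in (0 : ℝ)..1, (1 - Real.cos (c * y)) = 1 - Real.sin y / y := by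
      rw [intervalIntegral.integral_sub (Continuous.intervalIntegrable (by fun_prop) _ _)
        (Continuous.intervalIntegrable (by fun_prop) _ _),
        intervalIntegral.integral_comp_mul_right _ hy]
      simp [div_eq_inv_mul]
    have h2 : Real.sin y / y ≤ 1 / 3 := by
      refine (le_abs_self _).trans ?_
      rw [abs_div]
      exact div_le_div₀ zero_le_one (Real.abs_sin_le_one y) (by norm_num) h
    rw [h1]
    have := min_le_left 1 (y ^ 2)
    linarith

/-- The truncated second moment of `f` is controlled by the integrals of `1 - cos (c f)` for
`c ∈ [0, 1]`, that is, by the real part of a Lévy–Khintchine exponent near the origin. -/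
theorem lintegral_min_one_sq_le {α : Type*} [MeasurableSpace α] {ν : Measure α} [SFinite ν]
    {f : α → ℝ} (hf : Measurable f) {M : ENNReal}
    (hM : ∀ c ∈ Set.Icc (0 : ℝ) 1, ∫⁻ x, ENNReal.ofReal (1 - Real.cos (c * f x)) ∂ν ≤ M) :
    ∫⁻ x, ENNReal.ofReal (min 1 (f x ^ 2)) ∂ν ≤ 15 * M := by
  have hpt (x : α) : ENNReal.ofReal (min 1 (f x ^ 2)) ≤
      15 * ∫⁻ c in Set.Ioc (0 : ℝ) 1, ENNReal.ofReal (1 - Real.cos (c * f x)) := by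
    rw [← ofReal_integral_eq_lintegral_ofReal]
    · refine (ENNReal.ofReal_le_ofReal (min_one_sq_le_integral_one_sub_cos (f x))).trans ?_
      rw [intervalIntegral.integral_of_le zero_le_one, ENNReal.ofReal_mul (by norm_num)]
      simp
    · exact (Continuous.intervalIntegrable (by fun_prop) 0 1).1
    · exact ae_of_all _ fun c => by simpa using Real.cos_le_one _
  calc ∫⁻ x, ENNReal.ofReal (min 1 (f x ^ 2)) ∂ν
      ≤ ∫⁻ x, (15 * ∫⁻ c in Set.Ioc (0 : ℝ) 1, ENNReal.ofReal (1 - Real.cos (c * f x))) ∂ν :=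
        lintegral_mono hpt
    _ = 15 * ∫⁻ x, (∫⁻ c in Set.Ioc (0 : ℝ) 1, ENNReal.ofReal (1 - Real.cos (c * f x))) ∂ν :=
        lintegral_const_mul' _ _ (by norm_num)
    _ = 15 * ∫⁻ c in Set.Ioc (0 : ℝ) 1, ∫⁻ x, ENNReal.ofReal (1 - Real.cos (c * f x)) ∂ν := by
        rw [lintegral_lintegral_swap]
        exact Measurable.aemeasurable (by fun_prop)
    _ ≤ 15 * ∫⁻ _c in Set.Ioc (0 : ℝ) 1, M :=
        mul_le_mul_right (setLIntegral_mono' measurableSet_Ioc fun c hc => hM c ⟨hc.1.le, hc.2⟩) _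
    _ = 15 * M := by simp


theorem min_one_abs_inner_le {E : Type*} [NormedAddCommGroup E] [InnerProductSpace ℝ E] (u x : E) :
    min 1 |⟪u, x⟫| ≤ (1 + ‖u‖) * min 1 ‖x‖ := by
  have h := abs_real_inner_le_norm u x
  have hu := norm_nonneg u
  have hx := norm_nonneg x
  rcases min_cases 1 ‖x‖ with ⟨h1, h2⟩ | ⟨h1, h2⟩
  · rw [h1]
    linarith [min_le_left 1 |⟪u, x⟫|]
  · rw [h1]
    nlinarith [min_le_right 1 |⟪u, x⟫|]

theorem min_one_sq_norm {E : Type*} [NormedAddCommGroup E] (x : E) : min 1 (‖x‖ ^ 2) = min 1 ‖x‖ * min 1 ‖x‖ := by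
  have hx := norm_nonneg x
  rcases min_cases 1 ‖x‖ with ⟨h1, h2⟩ | ⟨h1, h2⟩ <;> rw [h1]
  · rw [min_eq_left]
    · norm_num
    · nlinarith
  · rw [min_eq_right]
    · ring
    · nlinarith

theorem min_one_sq_eq (y : ℝ) : min 1 (y ^ 2) = min 1 |y| * min 1 |y| := by
  simpa using min_one_sq_norm (E := ℝ) y

/-! ### Integrals against the Lévy measure of a triplet -/

section Analysis

variable {E : Type*} [NormedAddCommGroup E] [InnerProductSpace ℝ E] [MeasurableSpace E]

/-- The truncated second moment `∫ min(1, ⟪θ, x⟫²) ν(dx)` of the Lévy measure in the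
direction `θ`. -/
noncomputable def Triplet.truncMoment (T : Triplet E) (θ : E) : ℝ :=
  ∫ x, min 1 (⟪θ, x⟫ ^ 2) ∂T.levyMeasure

/-- The truncated mixed moment `∫ min(1, |⟪u, x⟫|) min(1, |⟪v, x⟫|) ν(dx)`; it measures how much
the Lévy measure charges points at which both `⟪u, x⟫` and `⟪v, x⟫` are nonzero. -/
noncomputable def Triplet.crossMoment (T : Triplet E) (u v : E) : ℝ :=
  ∫ x, min 1 |⟪u, x⟫| * min 1 |⟪v, x⟫| ∂T.levyMeasure

/-- The difference of Lévy–Khintchine exponents `ψ(u + v) - ψ(u) - ψ(v)` without its drift and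
truncation terms, which cancel. -/
noncomputable def Triplet.codifference (T : Triplet E) (u v : E) : ℂ :=
  -((⟪u, T.gaussianCov v⟫ : ℝ) : ℂ) + ∫ x, (Complex.exp (Complex.I * (⟪u, x⟫ : ℝ)) - 1) *
    (Complex.exp (Complex.I * (⟪v, x⟫ : ℝ)) - 1) ∂T.levyMeasure

namespace Triplet.IsTripletOf

variable {T : Triplet E} {μ : Measure E}

theorem integrable_of_norm_le (hT : T.IsTripletOf μ) {F : Type*} [NormedAddCommGroup F]
    {f : E → F} (hf : AEStronglyMeasurable f T.levyMeasure) (C : ℝ)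
    (h : ∀ x, ‖f x‖ ≤ C * min 1 (‖x‖ ^ 2)) : Integrable f T.levyMeasure :=
  (hT.integrable_levyMeasure.const_mul C).mono' hf (ae_of_all _ h)

theorem charFun_ne_zero (hT : T.IsTripletOf μ) (θ : E) : charFun μ θ ≠ 0 := by
  rw [hT.charFun_eq]
  exact Complex.exp_ne_zero _

variable [BorelSpace E]

/-- The Lévy measure has a positive integrable function off the null set `{0}`. -/
theorem sFinite (hT : T.IsTripletOf μ) : SFinite T.levyMeasure := by
  have hmeas : Measurable fun x : E => ENNReal.ofReal (min 1 (‖x‖ ^ 2)) :=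
    ENNReal.measurable_ofReal.comp (Continuous.measurable (by fun_prop))
  have hfin : IsFiniteMeasure
      (T.levyMeasure.withDensity fun x : E => ENNReal.ofReal (min 1 (‖x‖ ^ 2))) :=
    isFiniteMeasure_withDensity_ofReal hT.integrable_levyMeasure.2
  rw [← withDensity_inv_same (μ := T.levyMeasure) hmeas ?_ (ae_of_all _ fun x => by simp)]
  · infer_instance
  · have h0 : ∀ᵐ x ∂T.levyMeasure, x ≠ 0 := by
      rw [ae_iff]
      simpa using hT.levyMeasure_zero
    filter_upwards [h0] with x hx
    have : 0 < min 1 (‖x‖ ^ 2) := lt_min one_pos (by positivity)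
    simpa only [ne_eq, ENNReal.ofReal_eq_zero, not_le] using this

theorem integrable_min_mul_min (hT : T.IsTripletOf μ) (u v : E) :
    Integrable (fun x => min 1 |⟪u, x⟫| * min 1 |⟪v, x⟫|) T.levyMeasure := by
  refine hT.integrable_of_norm_le (Continuous.aestronglyMeasurable (by fun_prop))
    ((1 + ‖u‖) * (1 + ‖v‖)) fun x => ?_
  have h1 : (0 : ℝ) ≤ min 1 |⟪u, x⟫| := le_min zero_le_one (abs_nonneg _)
  have h2 : (0 : ℝ) ≤ min 1 |⟪v, x⟫| := le_min zero_le_one (abs_nonneg _)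
  rw [Real.norm_of_nonneg (mul_nonneg h1 h2), min_one_sq_norm, mul_mul_mul_comm]
  exact mul_le_mul (min_one_abs_inner_le u x) (min_one_abs_inner_le v x) h2 (h1.trans
    (min_one_abs_inner_le u x))

theorem integrable_of_le_min_mul_min (hT : T.IsTripletOf μ) {F : Type*} [NormedAddCommGroup F]
    {f : E → F} (hf : AEStronglyMeasurable f T.levyMeasure) (C : ℝ) (u v : E)
    (h : ∀ x, ‖f x‖ ≤ C * (min 1 |⟪u, x⟫| * min 1 |⟪v, x⟫|)) : Integrable f T.levyMeasure :=
  ((hT.integrable_min_mul_min u v).const_mul C).mono' hf (ae_of_all _ h)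

theorem integrable_min_sq (hT : T.IsTripletOf μ) (u : E) :
    Integrable (fun x => min 1 (⟪u, x⟫ ^ 2)) T.levyMeasure := by
  simp_rw [min_one_sq_eq]
  exact hT.integrable_min_mul_min u u

theorem integrable_one_sub_cos (hT : T.IsTripletOf μ) (u : E) :
    Integrable (fun x => 1 - Real.cos ⟪u, x⟫) T.levyMeasure := by
  refine hT.integrable_of_le_min_mul_min (Continuous.aestronglyMeasurable (by fun_prop)) 2 u u
    fun x => ?_
  rw [Real.norm_of_nonneg (by linarith [Real.cos_le_one ⟪u, x⟫]), ← min_one_sq_eq]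
  exact one_sub_cos_le_min _

theorem norm_exp_mul_exp_le (u v x : E) :
    ‖(Complex.exp (Complex.I * (⟪u, x⟫ : ℝ)) - 1) * (Complex.exp (Complex.I * (⟪v, x⟫ : ℝ)) - 1)‖
      ≤ 4 * (min 1 |⟪u, x⟫| * min 1 |⟪v, x⟫|) := by
  rw [norm_mul]
  have h := mul_le_mul (norm_exp_I_mul_sub_one_le_min ⟪u, x⟫)
    (norm_exp_I_mul_sub_one_le_min ⟪v, x⟫) (norm_nonneg _) (by positivity)
  linarith

theorem integrable_exp_mul_exp (hT : T.IsTripletOf μ) (u v : E) :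
    Integrable (fun x => (Complex.exp (Complex.I * (⟪u, x⟫ : ℝ)) - 1) *
      (Complex.exp (Complex.I * (⟪v, x⟫ : ℝ)) - 1)) T.levyMeasure :=
  hT.integrable_of_le_min_mul_min (Continuous.aestronglyMeasurable (by fun_prop)) 4 u v
    fun x => norm_exp_mul_exp_le u v x

theorem integrable_exponent (hT : T.IsTripletOf μ) (θ : E) :
    Integrable (fun x => Complex.exp (Complex.I * (⟪θ, x⟫ : ℝ)) - 1
        - Complex.I * (⟪θ, x⟫ : ℝ) *
          (Metric.closedBall (0 : E) 1).indicator (fun _ => (1 : ℂ)) x) T.levyMeasure := by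
  refine hT.integrable_of_norm_le (Measurable.aestronglyMeasurable ?_) (3 * (1 + ‖θ‖) ^ 2)
    fun x => ?_
  · have h1 : Measurable fun x : E => ((⟪θ, x⟫ : ℝ) : ℂ) := Continuous.measurable (by fun_prop)
    exact ((Complex.measurable_exp.comp (h1.const_mul _)).sub_const _).sub
      ((h1.const_mul _).mul (measurable_const.indicator measurableSet_closedBall))
  · have hθ := norm_nonneg θ
    have hx := norm_nonneg x
    by_cases h : x ∈ Metric.closedBall (0 : E) 1
    · rw [Set.indicator_of_mem h, mul_one]
      rw [mem_closedBall_zero_iff] at h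
      rw [min_eq_right (by nlinarith)]
      refine (norm_exp_I_mul_sub_one_sub_le _).trans ?_
      have h1 := abs_real_inner_le_norm θ x
      have h2 : ⟪θ, x⟫ ^ 2 ≤ (‖θ‖ * ‖x‖) ^ 2 := sq_le_sq' (by linarith [(abs_le.1 h1).1])
        (abs_le.1 h1).2
      nlinarith [sq_nonneg ‖x‖, mul_nonneg hθ (sq_nonneg ‖x‖)]
    · rw [Set.indicator_of_notMem h, mul_zero, sub_zero]
      rw [mem_closedBall_zero_iff, not_le] at h
      rw [min_eq_left (by nlinarith)]
      have h1 := norm_exp_I_mul_sub_one_le_min ⟪θ, x⟫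
      have h2 := min_le_left 1 |⟪θ, x⟫|
      nlinarith

theorem re_exponent (hT : T.IsTripletOf μ) (θ : E) :
    (T.exponent θ).re = -(⟪θ, T.gaussianCov θ⟫ / 2)
      - ∫ x, (1 - Real.cos ⟪θ, x⟫) ∂T.levyMeasure := by
  have h := integral_re (hT.integrable_exponent θ)
  simp only [RCLike.re_eq_complex_re] at h
  simp only [Triplet.exponent, Complex.add_re, ← h, sub_eq_add_neg _ (∫ x, _ ∂_),
    ← integral_neg]
  congr 1
  · simp
  · refine integral_congr_ae (ae_of_all _ fun x => ?_)
    by_cases h : x ∈ Metric.closedBall (0 : E) 1 <;>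
    simp [h, Complex.exp_re]

theorem norm_charFun (hT : T.IsTripletOf μ) (θ : E) :
    ‖charFun μ θ‖ = Real.exp (T.exponent θ).re := by
  rw [hT.charFun_eq, Complex.norm_exp]

/-- Drift and truncation are linear in `θ`, hence do not contribute to
`ψ(u + v) - ψ(u) - ψ(v)`. -/
theorem exponent_add (hT : T.IsTripletOf μ) (u v : E) :
    T.exponent (u + v) = T.exponent u + T.exponent v + T.codifference u v := by
  have hsymm : ⟪v, T.gaussianCov u⟫ = ⟪u, T.gaussianCov v⟫ := by
    rw [real_inner_comm]
    exact hT.gaussianCov_pos.isSymmetric u v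
  have hint : ∫ x, (Complex.exp (Complex.I * (⟪u + v, x⟫ : ℝ)) - 1
        - Complex.I * (⟪u + v, x⟫ : ℝ) *
          (Metric.closedBall (0 : E) 1).indicator (fun _ => (1 : ℂ)) x) ∂T.levyMeasure =
      (∫ x, (Complex.exp (Complex.I * (⟪u, x⟫ : ℝ)) - 1
        - Complex.I * (⟪u, x⟫ : ℝ) *
          (Metric.closedBall (0 : E) 1).indicator (fun _ => (1 : ℂ)) x) ∂T.levyMeasure) +
      (∫ x, (Complex.exp (Complex.I * (⟪v, x⟫ : ℝ)) - 1
        - Complex.I * (⟪v, x⟫ : ℝ) *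
          (Metric.closedBall (0 : E) 1).indicator (fun _ => (1 : ℂ)) x) ∂T.levyMeasure) +
      ∫ x, (Complex.exp (Complex.I * (⟪u, x⟫ : ℝ)) - 1) *
        (Complex.exp (Complex.I * (⟪v, x⟫ : ℝ)) - 1) ∂T.levyMeasure := by
    rw [← integral_add (hT.integrable_exponent u) (hT.integrable_exponent v)]
    refine Eq.trans ?_ (integral_add ((hT.integrable_exponent u).add (hT.integrable_exponent v))
      (hT.integrable_exp_mul_exp u v))
    refine integral_congr_ae (ae_of_all _ fun x => ?_)
    simp only [inner_add_left, Complex.ofReal_add, mul_add, Complex.exp_add]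
    ring
  rw [Triplet.exponent, Triplet.exponent, Triplet.exponent, Triplet.codifference, hint,
    inner_add_right, map_add, inner_add_left, inner_add_right, inner_add_right, hsymm]
  push_cast
  ring

theorem charFun_add (hT : T.IsTripletOf μ) (u v : E) :
    charFun μ (u + v) = charFun μ u * charFun μ v * Complex.exp (T.codifference u v) := by
  rw [hT.charFun_eq, hT.charFun_eq, hT.charFun_eq, hT.exponent_add, Complex.exp_add,
    Complex.exp_add]

theorem norm_codifference_le (hT : T.IsTripletOf μ) (u v : E) :
    ‖T.codifference u v‖ ≤ |⟪u, T.gaussianCov v⟫| + 4 * T.crossMoment u v := by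
  refine (norm_add_le _ _).trans (add_le_add ?_ ?_)
  · rw [norm_neg, Complex.norm_real, Real.norm_eq_abs]
  · rw [Triplet.crossMoment, ← integral_const_mul]
    exact norm_integral_le_of_norm_le ((hT.integrable_min_mul_min u v).const_mul 4)
      (ae_of_all _ fun x => norm_exp_mul_exp_le u v x)

theorem re_codifference (hT : T.IsTripletOf μ) (u v : E) :
    (T.codifference u v).re = -⟪u, T.gaussianCov v⟫
      + ∫ x, ((1 - Real.cos ⟪u, x⟫) * (1 - Real.cos ⟪v, x⟫) - Real.sin ⟪u, x⟫ * Real.sin ⟪v, x⟫)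
        ∂T.levyMeasure := by
  have h := integral_re (hT.integrable_exp_mul_exp u v)
  simp only [RCLike.re_eq_complex_re] at h
  rw [Triplet.codifference, Complex.add_re, ← h]
  congr 1
  refine integral_congr_ae (ae_of_all _ fun x => ?_)
  simp [Complex.exp_re, Complex.exp_im]
  ring

theorem truncMoment_nonneg (T : Triplet E) (u : E) : 0 ≤ T.truncMoment u :=
  integral_nonneg fun _ => le_min zero_le_one (sq_nonneg _)

theorem crossMoment_nonneg (T : Triplet E) (u v : E) : 0 ≤ T.crossMoment u v :=
  integral_nonneg fun _ => by positivity

theorem integral_one_sub_cos_le (hT : T.IsTripletOf μ) (u : E) :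
    ∫ x, (1 - Real.cos ⟪u, x⟫) ∂T.levyMeasure ≤ 2 * T.truncMoment u := by
  rw [Triplet.truncMoment, ← integral_const_mul]
  exact integral_mono (hT.integrable_one_sub_cos u) ((hT.integrable_min_sq u).const_mul 2)
    fun x => one_sub_cos_le_min _

theorem tendsto_truncMoment_zero (hT : T.IsTripletOf μ) (u : E) :
    Tendsto (fun s : ℝ => T.truncMoment (s • u)) (𝓝 0) (𝓝 0) := by
  suffices h : Tendsto (fun s : ℝ => T.truncMoment (s • u)) (𝓝 0)
      (𝓝 (∫ _x, (0 : ℝ) ∂T.levyMeasure)) by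
    rwa [integral_zero] at h
  refine tendsto_integral_filter_of_dominated_convergence (fun x => min 1 (⟪u, x⟫ ^ 2))
    (Eventually.of_forall fun s => Continuous.aestronglyMeasurable (by fun_prop)) ?_
    (hT.integrable_min_sq u) (ae_of_all _ fun x => ?_)
  · filter_upwards [Metric.closedBall_mem_nhds (0 : ℝ) one_pos] with s hs
    refine ae_of_all _ fun x => ?_
    rw [mem_closedBall_zero_iff, Real.norm_eq_abs] at hs
    rw [Real.norm_of_nonneg (by positivity), real_inner_smul_left, mul_pow]
    refine min_le_min le_rfl (mul_le_of_le_one_left (sq_nonneg _) ?_)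
    rw [← sq_abs]
    nlinarith [abs_nonneg s]
  · have : Continuous fun s : ℝ => min 1 (⟪s • u, x⟫ ^ 2) := by fun_prop
    simpa using this.tendsto 0

theorem tendsto_truncMoment_div_sq (hT : T.IsTripletOf μ) (u : E) :
    Tendsto (fun s : ℝ => T.truncMoment (s • u) / s ^ 2) atTop (𝓝 0) := by
  simp_rw [Triplet.truncMoment, ← integral_div]
  have hle : ∀ s : ℝ, 1 ≤ s → ∀ x, min 1 (⟪s • u, x⟫ ^ 2) / s ^ 2 = min (1 / s ^ 2) (⟪u, x⟫ ^ 2) := by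
    intro s hs x
    rw [← min_div_div_right (by positivity), real_inner_smul_left, mul_pow,
      mul_div_cancel_left₀ _ (by positivity)]
  refine (integral_zero E ℝ (μ := T.levyMeasure)) ▸
    tendsto_integral_filter_of_dominated_convergence (fun x => min 1 (⟪u, x⟫ ^ 2))
    (Eventually.of_forall fun s => Continuous.aestronglyMeasurable (by fun_prop)) ?_
    (hT.integrable_min_sq u) (ae_of_all _ fun x => ?_)
  · filter_upwards [eventually_ge_atTop (1 : ℝ)] with s hs
    refine ae_of_all _ fun x => ?_
    rw [Real.norm_of_nonneg (by positivity), hle s hs]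
    refine min_le_min ?_ le_rfl
    rw [div_le_one (by positivity)]
    nlinarith
  · have h1 : Tendsto (fun s : ℝ => min (1 / s ^ 2) (⟪u, x⟫ ^ 2)) atTop (𝓝 0) := by
      have h2 : Tendsto (fun s : ℝ => 1 / s ^ 2) atTop (𝓝 0) := by
        simpa using tendsto_pow_neg_atTop (𝕜 := ℝ) (n := 2) (by norm_num)
      have := h2.min (tendsto_const_nhds (x := ⟪u, x⟫ ^ 2))
      rwa [min_eq_left (sq_nonneg _)] at this
    refine h1.congr' ?_
    filter_upwards [eventually_ge_atTop (1 : ℝ)] with s hs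
    rw [hle s hs]

/-- The Gaussian variance in the direction `u` is read off from the growth of the exponent
along the ray through `u`. -/
theorem tendsto_re_exponent_div_sq (hT : T.IsTripletOf μ) (u : E) :
    Tendsto (fun s : ℝ => (T.exponent (s • u)).re / s ^ 2) atTop
      (𝓝 (-(⟪u, T.gaussianCov u⟫ / 2))) := by
  have h1 : Tendsto (fun s : ℝ => (∫ x, (1 - Real.cos ⟪s • u, x⟫) ∂T.levyMeasure) / s ^ 2) atTop
      (𝓝 0) := by
    refine squeeze_zero (fun s => div_nonneg (integral_nonneg fun x => ?_) (sq_nonneg s))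
      (fun s => ?_) (by simpa using (hT.tendsto_truncMoment_div_sq u).const_mul 2)
    · simpa using Real.cos_le_one _
    · rw [← mul_div_assoc]
      exact div_le_div_of_nonneg_right (hT.integral_one_sub_cos_le _) (sq_nonneg s)
  have h2 := (tendsto_const_nhds (x := -(⟪u, T.gaussianCov u⟫ / 2)) (f := atTop)).sub h1
  rw [sub_zero] at h2
  refine h2.congr' ?_
  filter_upwards [eventually_gt_atTop (0 : ℝ)] with s hs
  rw [hT.re_exponent, map_smul, real_inner_smul_left, real_inner_smul_right]
  field_simp

end Triplet.IsTripletOf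

/-- Triplets whose distributions have the same marginal in the direction `u` have the same
integrals of `1 - cos (c ⟪u, x⟫)`. -/
theorem integral_one_sub_cos_eq [BorelSpace E] {T T' : Triplet E} {μ μ' : Measure E}
    (hT : T.IsTripletOf μ) (hT' : T'.IsTripletOf μ') {u : E}
    (h : ∀ c : ℝ, charFun μ (c • u) = charFun μ' (c • u)) (c : ℝ) :
    ∫ x, (1 - Real.cos ⟪c • u, x⟫) ∂T.levyMeasure =
      ∫ x, (1 - Real.cos ⟪c • u, x⟫) ∂T'.levyMeasure := by
  have hre (c : ℝ) : (T.exponent (c • u)).re = (T'.exponent (c • u)).re := by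
    rw [← Real.exp_eq_exp, ← hT.norm_charFun, ← hT'.norm_charFun, h]
  have hA : ⟪u, T.gaussianCov u⟫ = ⟪u, T'.gaussianCov u⟫ := by
    have h1 := hT.tendsto_re_exponent_div_sq u
    simp_rw [hre] at h1
    have := tendsto_nhds_unique h1 (hT'.tendsto_re_exponent_div_sq u)
    linarith
  have h1 := hre c
  rw [hT.re_exponent, hT'.re_exponent, map_smul, map_smul, real_inner_smul_left,
    real_inner_smul_right, real_inner_smul_left, real_inner_smul_right, hA] at h1
  linarith

/-- For distributions with the same marginal in the direction `u`, the truncated second moments of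
the Lévy measures in this direction are comparable, uniformly in the scale. This replaces the
equality of the projected Lévy measures, which would need the uniqueness of the triplet. -/
theorem truncMoment_le [BorelSpace E] {T T' : Triplet E} {μ μ' : Measure E}
    (hT : T.IsTripletOf μ) (hT' : T'.IsTripletOf μ') {u : E}
    (h : ∀ c : ℝ, charFun μ (c • u) = charFun μ' (c • u)) (s : ℝ) :
    T.truncMoment (s • u) ≤ 30 * T'.truncMoment (s • u) := by
  have := hT.sFinite
  have hmeas : Measurable fun x : E => ⟪s • u, x⟫ := Continuous.measurable (by fun_prop)
  have hM : ∀ c ∈ Set.Icc (0 : ℝ) 1,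
      ∫⁻ x, ENNReal.ofReal (1 - Real.cos (c * ⟪s • u, x⟫)) ∂T.levyMeasure ≤
        ENNReal.ofReal (2 * T'.truncMoment (s • u)) := by
    intro c hc
    have h1 := integral_one_sub_cos_eq hT hT' h (c * s)
    have hc' (x : E) : c * ⟪s • u, x⟫ = ⟪(c * s) • u, x⟫ := by
      rw [mul_smul, real_inner_smul_left _ _ c]
    simp_rw [hc']
    rw [← ofReal_integral_eq_lintegral_ofReal (hT.integrable_one_sub_cos _)
      (ae_of_all _ fun x => by simpa using Real.cos_le_one _), h1]
    refine ENNReal.ofReal_le_ofReal ((hT'.integral_one_sub_cos_le _).trans ?_)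
    refine mul_le_mul_of_nonneg_left (integral_mono (hT'.integrable_min_sq _)
      (hT'.integrable_min_sq _) fun x => min_le_min le_rfl ?_) zero_le_two
    rw [mul_smul, real_inner_smul_left, mul_pow]
    exact mul_le_of_le_one_left (sq_nonneg _) (pow_le_one₀ hc.1 hc.2)
  have h2 := lintegral_min_one_sq_le hmeas hM
  rw [← ofReal_integral_eq_lintegral_ofReal (hT.integrable_min_sq _)
    (ae_of_all _ fun x => le_min zero_le_one (sq_nonneg _)),
    show (15 : ENNReal) = ENNReal.ofReal 15 by simp, ← ENNReal.ofReal_mul (by norm_num),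
    ENNReal.ofReal_le_ofReal_iff] at h2
  · rw [Triplet.truncMoment]
    linarith
  · have := Triplet.IsTripletOf.truncMoment_nonneg T' (s • u)
    positivity

end Analysis


/-! ### Asymptotic independence of two directions -/

section Asymptotic

variable {E : Type*} [NormedAddCommGroup E] [InnerProductSpace ℝ E] [MeasurableSpace E]
  [BorelSpace E]

/-- Bound for `min(1, |a|) min(1, |b|)` in which `g` takes care of the points with both `|a|` and
`|b|` above `ε`; elsewhere the smaller factor is absorbed with weight `η` by Young's inequality. -/
theorem min_mul_min_le {a b g ε η : ℝ} (hε : 0 < ε) (hη : 0 < η) (hg : 0 ≤ g)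
    (h : ε < |a| → ε < |b| → 1 ≤ g) :
    min 1 |a| * min 1 |b| ≤ g + (ε ^ 2 / η * (min 1 ((ε⁻¹ * a) ^ 2) + min 1 ((ε⁻¹ * b) ^ 2)) +
      η * (min 1 (a ^ 2) + min 1 (b ^ 2))) := by
  have key : ∀ a b : ℝ, |a| ≤ ε → min 1 |a| * min 1 |b| ≤
      ε ^ 2 / η * min 1 ((ε⁻¹ * a) ^ 2) + η * min 1 (b ^ 2) := by
    intro a b hab
    have h1 : (ε⁻¹ * a) ^ 2 ≤ 1 := by
      rw [← sq_abs, abs_mul, abs_of_pos (inv_pos.2 hε)]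
      refine pow_le_one₀ (by positivity) ?_
      rw [inv_mul_le_iff₀ hε]
      linarith
    rw [min_eq_right h1, min_one_sq_eq b]
    have h2 : ε ^ 2 / η * (ε⁻¹ * a) ^ 2 = |a| * |a| / η := by
      rw [abs_mul_abs_self]
      field_simp
    rw [h2]
    have h3 : (0 : ℝ) ≤ min 1 |b| := by positivity
    have h4 : min 1 |a| * min 1 |b| ≤ |a| * min 1 |b| :=
      mul_le_mul_of_nonneg_right (min_le_right _ _) h3
    refine h4.trans ?_
    have h5 : |a| * |a| / η + η * (min 1 |b| * min 1 |b|) - 2 * (|a| * min 1 |b|) =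
        (|a| - η * min 1 |b|) ^ 2 / η := by
      field_simp
      ring
    have h6 : 0 ≤ (|a| - η * min 1 |b|) ^ 2 / η := by positivity
    have h7 : 0 ≤ |a| * min 1 |b| := by positivity
    linarith
  have hA : 0 ≤ ε ^ 2 / η * min 1 ((ε⁻¹ * a) ^ 2) := by positivity
  have hB : 0 ≤ ε ^ 2 / η * min 1 ((ε⁻¹ * b) ^ 2) := by positivity
  have hC : 0 ≤ η * min 1 (a ^ 2) := by positivity
  have hD : 0 ≤ η * min 1 (b ^ 2) := by positivity
  by_cases ha : |a| ≤ ε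
  · linarith [key a b ha]
  by_cases hb : |b| ≤ ε
  · linarith [key b a hb]
  have h1 : min 1 |a| * min 1 |b| ≤ 1 :=
    mul_le_one₀ (min_le_left _ _) (by positivity) (min_le_left _ _)
  linarith [h (not_le.1 ha) (not_le.1 hb)]

theorem crossMoment_le {T : Triplet E} {μ : Measure E} (hT : T.IsTripletOf μ) (u v : E)
    {g : E → ℝ} (hgi : Integrable g T.levyMeasure) (hg : ∀ x, 0 ≤ g x) {ε η : ℝ} (hε : 0 < ε)
    (hη : 0 < η) (h : ∀ x, ε < |⟪u, x⟫| → ε < |⟪v, x⟫| → 1 ≤ g x) :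
    T.crossMoment u v ≤ ∫ x, g x ∂T.levyMeasure +
      (ε ^ 2 / η * (T.truncMoment (ε⁻¹ • u) + T.truncMoment (ε⁻¹ • v)) +
        η * (T.truncMoment u + T.truncMoment v)) := by
  have i1 := ((hT.integrable_min_sq (ε⁻¹ • u)).add (hT.integrable_min_sq (ε⁻¹ • v))).const_mul
    (ε ^ 2 / η)
  have i2 := ((hT.integrable_min_sq u).add (hT.integrable_min_sq v)).const_mul η
  have i3 := hgi.add (i1.add i2)
  have e : ∫ x, g x ∂T.levyMeasure +
      (ε ^ 2 / η * (T.truncMoment (ε⁻¹ • u) + T.truncMoment (ε⁻¹ • v)) +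
        η * (T.truncMoment u + T.truncMoment v)) = ∫ x, (g x + (ε ^ 2 / η *
          (min 1 (⟪ε⁻¹ • u, x⟫ ^ 2) + min 1 (⟪ε⁻¹ • v, x⟫ ^ 2)) +
            η * (min 1 (⟪u, x⟫ ^ 2) + min 1 (⟪v, x⟫ ^ 2)))) ∂T.levyMeasure := by
    refine Eq.symm ((integral_add hgi (i1.add i2)).trans ?_)
    congr 1
    refine (integral_add i1 i2).trans ?_
    rw [integral_const_mul, integral_const_mul]
    congr 2
    · exact integral_add (hT.integrable_min_sq (ε⁻¹ • u)) (hT.integrable_min_sq (ε⁻¹ • v))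
    · exact integral_add (hT.integrable_min_sq u) (hT.integrable_min_sq v)
  rw [e]
  refine integral_mono (hT.integrable_min_mul_min u v) i3 fun x => ?_
  simp only [real_inner_smul_left]
  exact min_mul_min_le hε hη (hg x) (h x)

/-- The marginal distribution in the direction `u` does not depend on `n`. -/
def ConstMarginal (μ : ℕ → Measure E) (u : E) : Prop :=
  ∀ (n : ℕ) (c : ℝ), charFun (μ n) (c • u) = charFun (μ 0) (c • u)

variable {T : ℕ → Triplet E} {μ : ℕ → Measure E} {u v : E}

/-- With constant marginals, the contribution to the mixed moments of the points at which one of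
the two coordinates is small is uniformly small. -/
theorem exists_crossMoment_le (hT : ∀ n, (T n).IsTripletOf (μ n)) (hu : ConstMarginal μ u)
    (hv : ConstMarginal μ v) {τ : ℝ} (hτ : 0 < τ) :
    ∃ ε : ℝ, 0 < ε ∧ ∀ n (g : E → ℝ), Integrable g (T n).levyMeasure → (∀ x, 0 ≤ g x) →
      (∀ x, ε < |⟪u, x⟫| → ε < |⟪v, x⟫| → 1 ≤ g x) →
      (T n).crossMoment u v ≤ ∫ x, g x ∂(T n).levyMeasure + τ := by
  have hVu := Triplet.IsTripletOf.truncMoment_nonneg (T 0) u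
  have hVv := Triplet.IsTripletOf.truncMoment_nonneg (T 0) v
  set B := 30 * ((T 0).truncMoment u + (T 0).truncMoment v) + 1 with hB
  have hBpos : 0 < B := by positivity
  set η := τ / (2 * B) with hη
  have hηpos : 0 < η := by positivity
  have hlim := ((hT 0).tendsto_truncMoment_div_sq u).add ((hT 0).tendsto_truncMoment_div_sq v)
  rw [add_zero] at hlim
  obtain ⟨s, hs, hs1⟩ := ((hlim.eventually (gt_mem_nhds (show 0 < τ * η / 60 by positivity))).and
    (eventually_ge_atTop (1 : ℝ))).exists
  have hs0 : 0 < s := by linarith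
  refine ⟨s⁻¹, inv_pos.2 hs0, fun n g hgi hg h => ?_⟩
  refine (crossMoment_le (hT n) u v hgi hg (inv_pos.2 hs0) hηpos h).trans ?_
  rw [inv_inv]
  have h1 := truncMoment_le (hT n) (hT 0) (hu n) s
  have h2 := truncMoment_le (hT n) (hT 0) (hv n) s
  have h3 := truncMoment_le (hT n) (hT 0) (hu n) 1
  have h4 := truncMoment_le (hT n) (hT 0) (hv n) 1
  rw [one_smul] at h3 h4
  have h5 : η * ((T n).truncMoment u + (T n).truncMoment v) ≤ τ / 2 := by
    calc η * ((T n).truncMoment u + (T n).truncMoment v) ≤ η * B :=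
          mul_le_mul_of_nonneg_left (by linarith) hηpos.le
      _ = τ / 2 := by rw [hη]; field_simp
  have h6 : s⁻¹ ^ 2 / η * ((T n).truncMoment (s • u) + (T n).truncMoment (s • v)) ≤ τ / 2 := by
    calc s⁻¹ ^ 2 / η * ((T n).truncMoment (s • u) + (T n).truncMoment (s • v))
        ≤ s⁻¹ ^ 2 / η * (30 * ((T 0).truncMoment (s • u) + (T 0).truncMoment (s • v))) :=
          mul_le_mul_of_nonneg_left (by linarith) (by positivity)
      _ = 30 / η * ((T 0).truncMoment (s • u) / s ^ 2 + (T 0).truncMoment (s • v) / s ^ 2) := by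
          field_simp
      _ ≤ 30 / η * (τ * η / 60) := mul_le_mul_of_nonneg_left hs.le (by positivity)
      _ = τ / 2 := by field_simp; norm_num
  linarith

/-- With constant marginals, large values of the two coordinates carry uniformly little mass. -/
theorem exists_tail_le (hT : ∀ n, (T n).IsTripletOf (μ n)) (hu : ConstMarginal μ u)
    (hv : ConstMarginal μ v) {τ : ℝ} (hτ : 0 < τ) :
    ∃ R : ℝ, 1 ≤ R ∧ ∀ n, (T n).truncMoment (R⁻¹ • u) + (T n).truncMoment (R⁻¹ • v) ≤ τ := by
  have hlim := (((hT 0).tendsto_truncMoment_zero u).add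
    ((hT 0).tendsto_truncMoment_zero v)).comp tendsto_inv_atTop_zero
  rw [add_zero] at hlim
  obtain ⟨R, hR, hR1⟩ := ((hlim.eventually (gt_mem_nhds (show 0 < τ / 30 by positivity))).and
    (eventually_ge_atTop (1 : ℝ))).exists
  refine ⟨R, hR1, fun n => ?_⟩
  have h1 := truncMoment_le (hT n) (hT 0) (hu n) R⁻¹
  have h2 := truncMoment_le (hT n) (hT 0) (hv n) R⁻¹
  simp only [Function.comp_apply] at hR
  linarith

theorem integrable_one_sub_cos_mul {T : Triplet E} {μ : Measure E} (hT : T.IsTripletOf μ)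
    (u v : E) : Integrable (fun x => (1 - Real.cos ⟪u, x⟫) * (1 - Real.cos ⟪v, x⟫))
      T.levyMeasure := by
  refine (hT.integrable_one_sub_cos u).mul_bdd (c := 2)
    (Continuous.aestronglyMeasurable (by fun_prop)) (ae_of_all _ fun x => ?_)
  rw [Real.norm_eq_abs, abs_le]
  constructor <;> linarith [Real.cos_le_one ⟪v, x⟫, Real.neg_one_le_cos ⟪v, x⟫]

theorem abs_sin_mul_sin_le (a b : ℝ) :
    |Real.sin a * Real.sin b| ≤ min 1 (a ^ 2) + min 1 (b ^ 2) := by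
  have h (y : ℝ) : Real.sin y ^ 2 ≤ min 1 (y ^ 2) :=
    le_min (Real.sin_sq_le_one y) (sq_le_sq.2 Real.abs_sin_le_abs)
  rw [abs_mul]
  nlinarith [h a, h b, sq_nonneg (|Real.sin a| - |Real.sin b|), sq_abs (Real.sin a),
    sq_abs (Real.sin b), sq_nonneg (Real.sin a), sq_nonneg (Real.sin b)]

theorem integrable_sin_mul_sin {T : Triplet E} {μ : Measure E} (hT : T.IsTripletOf μ)
    (u v : E) : Integrable (fun x => Real.sin ⟪u, x⟫ * Real.sin ⟪v, x⟫) T.levyMeasure :=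
  ((hT.integrable_min_sq u).add (hT.integrable_min_sq v)).mono'
    (Continuous.aestronglyMeasurable (by fun_prop)) (ae_of_all _ fun _ => abs_sin_mul_sin_le _ _)

/-- The directions `u` and `v` are asymptotically independent: the joint characteristic function
of `⟪u, ·⟫` and `⟪v, ·⟫` converges to the product of the marginal ones. The marginals are those of
`μ 0`; the notion is used for sequences with constant marginals. -/
def AsymptoticallyIndependent (μ : ℕ → Measure E) (u v : E) : Prop :=
  ∀ c c' : ℝ, Tendsto (fun n => charFun (μ n) (c • u + c' • v)) atTop
    (𝓝 (charFun (μ 0) (c • u) * charFun (μ 0) (c' • v)))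

/-- Only the modulus of the characteristic functions is used, so that no branch of the logarithm
has to be followed. -/
theorem tendsto_re_codifference (hT : ∀ n, (T n).IsTripletOf (μ n)) (hu : ConstMarginal μ u)
    (hv : ConstMarginal μ v) (h : AsymptoticallyIndependent μ u v) (c c' : ℝ) :
    Tendsto (fun n => ((T n).codifference (c • u) (c' • v)).re) atTop (𝓝 0) := by
  have h0 : charFun (μ 0) (c • u) * charFun (μ 0) (c' • v) ≠ 0 :=
    mul_ne_zero ((hT 0).charFun_ne_zero _) ((hT 0).charFun_ne_zero _)
  have h1 := (h c c').div_const (charFun (μ 0) (c • u) * charFun (μ 0) (c' • v))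
  rw [div_self h0] at h1
  have h2 (n : ℕ) : charFun (μ n) (c • u + c' • v) /
      (charFun (μ 0) (c • u) * charFun (μ 0) (c' • v)) =
      Complex.exp ((T n).codifference (c • u) (c' • v)) := by
    rw [(hT n).charFun_add, hu n, hv n, mul_div_cancel_left₀ _ h0]
  simp_rw [h2] at h1
  have h3 := h1.norm
  simp_rw [Complex.norm_exp, norm_one] at h3
  have h4 := h3.log one_ne_zero
  simpa using h4

theorem tendsto_integral_one_sub_cos_mul (hT : ∀ n, (T n).IsTripletOf (μ n))
    (hu : ConstMarginal μ u) (hv : ConstMarginal μ v) (h : AsymptoticallyIndependent μ u v)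
    (c : ℝ) :
    Tendsto (fun n => ∫ x, (1 - Real.cos ⟪c • u, x⟫) * (1 - Real.cos ⟪c • v, x⟫)
      ∂(T n).levyMeasure) atTop (𝓝 0) := by
  have h1 := ((tendsto_re_codifference hT hu hv h c c).add
    (tendsto_re_codifference hT hu hv h c (-c))).div_const 2
  rw [add_zero, zero_div] at h1
  refine h1.congr fun n => ?_
  rw [(hT n).re_codifference, (hT n).re_codifference,
    integral_sub (integrable_one_sub_cos_mul (hT n) _ _) (integrable_sin_mul_sin (hT n) _ _),
    integral_sub (integrable_one_sub_cos_mul (hT n) _ _) (integrable_sin_mul_sin (hT n) _ _)]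
  simp only [neg_smul, map_neg, inner_neg_right, inner_neg_left, Real.cos_neg, Real.sin_neg,
    mul_neg, integral_neg]
  ring

theorem tendsto_inner_gaussianCov_add (hT : ∀ n, (T n).IsTripletOf (μ n))
    (hu : ConstMarginal μ u) (hv : ConstMarginal μ v) (h : AsymptoticallyIndependent μ u v)
    (c : ℝ) :
    Tendsto (fun n => c ^ 2 * ⟪u, (T n).gaussianCov v⟫ +
      ∫ x, Real.sin ⟪c • u, x⟫ * Real.sin ⟪c • v, x⟫ ∂(T n).levyMeasure) atTop (𝓝 0) := by
  have h1 := ((tendsto_re_codifference hT hu hv h c (-c)).sub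
    (tendsto_re_codifference hT hu hv h c c)).div_const 2
  rw [sub_zero, zero_div] at h1
  refine h1.congr fun n => ?_
  rw [(hT n).re_codifference, (hT n).re_codifference,
    integral_sub (integrable_one_sub_cos_mul (hT n) _ _) (integrable_sin_mul_sin (hT n) _ _),
    integral_sub (integrable_one_sub_cos_mul (hT n) _ _) (integrable_sin_mul_sin (hT n) _ _)]
  simp only [neg_smul, map_neg, inner_neg_right, inner_neg_left, Real.cos_neg, Real.sin_neg,
    mul_neg, integral_neg, map_smul, real_inner_smul_left, real_inner_smul_right]
  ring

/-- Asymptotic independence forces the Gaussian covariance to vanish: the jump part contributes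
only `o(c²)` to the codifference at `(c u, c v)`, uniformly in `n`. -/
theorem AsymptoticallyIndependent.tendsto_gaussianCov (hT : ∀ n, (T n).IsTripletOf (μ n))
    (hu : ConstMarginal μ u) (hv : ConstMarginal μ v) (h : AsymptoticallyIndependent μ u v) :
    Tendsto (fun n => ⟪u, (T n).gaussianCov v⟫) atTop (𝓝 0) := by
  rw [Metric.tendsto_atTop']
  intro τ hτ
  have hlim := ((hT 0).tendsto_truncMoment_div_sq u).add ((hT 0).tendsto_truncMoment_div_sq v)
  rw [add_zero] at hlim
  obtain ⟨s, hs, hs1⟩ := ((hlim.eventually (gt_mem_nhds (show 0 < τ / 60 by positivity))).and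
    (eventually_ge_atTop (1 : ℝ))).exists
  obtain ⟨N, hN⟩ := Metric.tendsto_atTop'.1 (tendsto_inner_gaussianCov_add hT hu hv h s)
    (τ / 2) (by positivity)
  refine ⟨N, fun n hn => ?_⟩
  have h1 := hN n hn
  rw [Real.dist_eq, sub_zero] at h1 ⊢
  have h2 : |∫ x, Real.sin ⟪s • u, x⟫ * Real.sin ⟪s • v, x⟫ ∂(T n).levyMeasure| ≤
      (T n).truncMoment (s • u) + (T n).truncMoment (s • v) := by
    rw [Triplet.truncMoment, Triplet.truncMoment,
      ← integral_add ((hT n).integrable_min_sq _) ((hT n).integrable_min_sq _),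
      ← Real.norm_eq_abs]
    exact norm_integral_le_of_norm_le
      (g := fun x => min 1 (⟪s • u, x⟫ ^ 2) + min 1 (⟪s • v, x⟫ ^ 2))
      (((hT n).integrable_min_sq _).add ((hT n).integrable_min_sq _))
      (ae_of_all _ fun x => abs_sin_mul_sin_le _ _)
  have h3 := truncMoment_le (hT n) (hT 0) (hu n) s
  have h4 := truncMoment_le (hT n) (hT 0) (hv n) s
  have hs2 : 0 < s ^ 2 := by positivity
  rw [← add_div, div_lt_iff₀ hs2] at hs
  have h5 : s ^ 2 * |⟪u, (T n).gaussianCov v⟫| < s ^ 2 * τ := by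
    rw [← abs_of_pos hs2, ← abs_mul, abs_of_pos hs2]
    have h6 := abs_add_le (s ^ 2 * ⟪u, (T n).gaussianCov v⟫ +
      ∫ x, Real.sin ⟪s • u, x⟫ * Real.sin ⟪s • v, x⟫ ∂(T n).levyMeasure)
      (-∫ x, Real.sin ⟪s • u, x⟫ * Real.sin ⟪s • v, x⟫ ∂(T n).levyMeasure)
    rw [add_neg_cancel_right, abs_neg] at h6
    have h7 : τ / 2 * 1 ≤ τ / 2 * s ^ 2 :=
      mul_le_mul_of_nonneg_left (one_le_pow₀ hs1) (by positivity)
    linarith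
  exact lt_of_mul_lt_mul_left h5 hs2.le

/-- Asymptotic independence forces the truncated mixed moment to vanish. Away from small and large
values of the two coordinates, which are uniformly negligible, the integrand is bounded by a multiple
of `(1 - cos (a / R)) (1 - cos (b / R))` for a single scale `R`. -/
theorem AsymptoticallyIndependent.tendsto_crossMoment (hT : ∀ n, (T n).IsTripletOf (μ n))
    (hu : ConstMarginal μ u) (hv : ConstMarginal μ v) (h : AsymptoticallyIndependent μ u v) :
    Tendsto (fun n => (T n).crossMoment u v) atTop (𝓝 0) := by
  rw [Metric.tendsto_atTop']
  intro τ hτ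
  obtain ⟨ε, hε, hK⟩ := exists_crossMoment_le hT hu hv (show 0 < τ / 3 by positivity)
  obtain ⟨R, hR, hV⟩ := exists_tail_le hT hu hv (show 0 < τ / 3 by positivity)
  have hR0 : 0 < R := by linarith
  -- On `ε < |a| ≤ R` one has `1 - cos (a / R) ≥ (a / R)² / 5 ≥ ε² / (5 R²)`.
  set κ := 5 * R ^ 2 / ε ^ 2 with hκ
  have hκ0 : 0 < κ := by positivity
  obtain ⟨N, hN⟩ := Metric.tendsto_atTop'.1
    (tendsto_integral_one_sub_cos_mul hT hu hv h R⁻¹) (τ / 3 / κ ^ 2) (by positivity)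
  refine ⟨N, fun n hn => ?_⟩
  have h1 := hN n hn
  rw [Real.dist_eq, sub_zero] at h1 ⊢
  rw [abs_of_nonneg (Triplet.IsTripletOf.crossMoment_nonneg _ _ _)]
  have i1 := (integrable_one_sub_cos_mul (hT n) (R⁻¹ • u) (R⁻¹ • v)).const_mul (κ ^ 2)
  have i2 := ((hT n).integrable_min_sq (R⁻¹ • u)).add ((hT n).integrable_min_sq (R⁻¹ • v))
  have h2 := hK n (fun x => κ ^ 2 * ((1 - Real.cos ⟪R⁻¹ • u, x⟫) * (1 - Real.cos ⟪R⁻¹ • v, x⟫)) +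
    (min 1 (⟪R⁻¹ • u, x⟫ ^ 2) + min 1 (⟪R⁻¹ • v, x⟫ ^ 2))) (i1.add i2) (fun x => ?_)
    (fun x hx hy => ?_)
  · have e : ∫ x, (κ ^ 2 * ((1 - Real.cos ⟪R⁻¹ • u, x⟫) * (1 - Real.cos ⟪R⁻¹ • v, x⟫)) +
        (min 1 (⟪R⁻¹ • u, x⟫ ^ 2) + min 1 (⟪R⁻¹ • v, x⟫ ^ 2))) ∂(T n).levyMeasure =
        κ ^ 2 * ∫ x, (1 - Real.cos ⟪R⁻¹ • u, x⟫) * (1 - Real.cos ⟪R⁻¹ • v, x⟫)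
          ∂(T n).levyMeasure + ((T n).truncMoment (R⁻¹ • u) + (T n).truncMoment (R⁻¹ • v)) := by
      refine (integral_add i1 i2).trans ?_
      rw [integral_const_mul]
      congr 1
      exact integral_add ((hT n).integrable_min_sq (R⁻¹ • u)) ((hT n).integrable_min_sq (R⁻¹ • v))
    rw [e] at h2
    have h3 := (le_abs_self _).trans_lt h1
    rw [lt_div_iff₀ (by positivity)] at h3
    linarith [hV n]
  · have h3 := sub_nonneg.2 (Real.cos_le_one ⟪R⁻¹ • u, x⟫)
    have h4 := sub_nonneg.2 (Real.cos_le_one ⟪R⁻¹ • v, x⟫)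
    positivity
  · have hcos (w : E) : 0 ≤ 1 - Real.cos ⟪R⁻¹ • w, x⟫ := sub_nonneg.2 (Real.cos_le_one _)
    have hmin (w : E) : 0 ≤ min 1 (⟪R⁻¹ • w, x⟫ ^ 2) := by positivity
    have hbig (w : E) (hw : R < |⟪w, x⟫|) : 1 ≤ min 1 (⟪R⁻¹ • w, x⟫ ^ 2) := by
      refine le_min le_rfl ?_
      rw [real_inner_smul_left, ← sq_abs, abs_mul, abs_of_pos (inv_pos.2 hR0)]
      refine one_le_pow₀ ?_
      rw [le_inv_mul_iff₀ hR0]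
      linarith
    have hmid (w : E) (hw : |⟪w, x⟫| ≤ R) (hw' : ε < |⟪w, x⟫|) :
        1 ≤ κ * (1 - Real.cos ⟪R⁻¹ • w, x⟫) := by
      have h3 : |⟪R⁻¹ • w, x⟫| ≤ 3 := by
        rw [real_inner_smul_left, abs_mul, abs_of_pos (inv_pos.2 hR0), inv_mul_le_iff₀ hR0]
        linarith
      have h4 := sq_le_mul_one_sub_cos h3
      have h5 : (R⁻¹ * ε) ^ 2 ≤ ⟪R⁻¹ • w, x⟫ ^ 2 := by
        rw [real_inner_smul_left, mul_pow, mul_pow]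
        refine mul_le_mul_of_nonneg_left ?_ (by positivity)
        rw [← sq_abs ⟪w, x⟫]
        exact pow_le_pow_left₀ hε.le hw'.le 2
      calc (1 : ℝ) = κ / 5 * (R⁻¹ * ε) ^ 2 := by rw [hκ]; field_simp
        _ ≤ κ / 5 * (5 * (1 - Real.cos ⟪R⁻¹ • w, x⟫)) :=
          mul_le_mul_of_nonneg_left (h5.trans h4) (by positivity)
        _ = κ * (1 - Real.cos ⟪R⁻¹ • w, x⟫) := by ring
    have h0 : 0 ≤ κ ^ 2 * ((1 - Real.cos ⟪R⁻¹ • u, x⟫) * (1 - Real.cos ⟪R⁻¹ • v, x⟫)) :=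
      mul_nonneg (sq_nonneg _) (mul_nonneg (hcos u) (hcos v))
    by_cases hu' : R < |⟪u, x⟫|
    · linarith [hbig u hu', hmin v]
    by_cases hv' : R < |⟪v, x⟫|
    · linarith [hbig v hv', hmin u]
    have h3 := one_le_mul_of_one_le_of_one_le (hmid u (not_lt.1 hu') hx) (hmid v (not_lt.1 hv') hy)
    nlinarith [hmin u, hmin v]

/-- Vanishing of the Lévy measure on `{|⟪u, x⟫ ⟪v, x⟫| > δ}` for all `δ > 0` implies vanishing of
the truncated mixed moment. -/
theorem tendsto_crossMoment_of_measure (hT : ∀ n, (T n).IsTripletOf (μ n))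
    (hu : ConstMarginal μ u) (hv : ConstMarginal μ v)
    (h : ∀ δ : ℝ, 0 < δ → Tendsto (fun n => (T n).levyMeasure {x | δ < |⟪u, x⟫| * |⟪v, x⟫|})
      atTop (𝓝 0)) :
    Tendsto (fun n => (T n).crossMoment u v) atTop (𝓝 0) := by
  rw [Metric.tendsto_atTop']
  intro τ hτ
  obtain ⟨ε, hε, hK⟩ := exists_crossMoment_le hT hu hv (show 0 < τ / 2 by positivity)
  have h1 := (h (ε ^ 2) (by positivity)).eventually
    (gt_mem_nhds (show (0 : ENNReal) < ENNReal.ofReal (τ / 2) by simpa using hτ))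
  obtain ⟨N, hN⟩ := eventually_atTop.1 h1
  refine ⟨N, fun n hn => ?_⟩
  rw [Real.dist_eq, sub_zero, abs_of_nonneg (Triplet.IsTripletOf.crossMoment_nonneg _ _ _)]
  set S := {x : E | ε ^ 2 < |⟪u, x⟫| * |⟪v, x⟫|} with hS
  have hSm : MeasurableSet S := (isOpen_lt (by fun_prop) (by fun_prop)).measurableSet
  have hlt := hN n hn.le
  have h2 := hK n (S.indicator fun _ => 1) ((integrable_indicator_iff hSm).2
    (integrableOn_const (hlt.trans_le le_top).ne)) (Set.indicator_nonneg fun _ _ => zero_le_one)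
    fun x hx hy => by
      rw [Set.indicator_of_mem]
      rw [hS, Set.mem_ofPred_eq, sq]
      exact mul_lt_mul'' hx hy hε.le hε.le
  rw [integral_indicator_const _ hSm, smul_eq_mul, mul_one] at h2
  have h3 : (T n).levyMeasure.real S < τ / 2 := by
    rw [measureReal_def]
    exact (ENNReal.lt_ofReal_iff_toReal_lt (hlt.trans_le le_top).ne).1 hlt
  linarith

/-- Converse of `tendsto_crossMoment_of_measure`: up to uniformly small tails, both factors are at
most `R`, and then `|⟪u, x⟫ ⟪v, x⟫| > δ` bounds both of them below by `δ / R`. -/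
theorem tendsto_measure_of_crossMoment (hT : ∀ n, (T n).IsTripletOf (μ n))
    (hu : ConstMarginal μ u) (hv : ConstMarginal μ v)
    (h : Tendsto (fun n => (T n).crossMoment u v) atTop (𝓝 0)) {δ : ℝ} (hδ : 0 < δ) :
    Tendsto (fun n => (T n).levyMeasure {x | δ < |⟪u, x⟫| * |⟪v, x⟫|}) atTop (𝓝 0) := by
  rw [ENNReal.tendsto_nhds_zero]
  intro τ' hτ'
  rcases eq_or_ne τ' ⊤ with rfl | htop
  · simp
  obtain ⟨τ, hτ, rfl⟩ : ∃ τ : ℝ, 0 < τ ∧ τ' = ENNReal.ofReal τ :=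
    ⟨τ'.toReal, ENNReal.toReal_pos hτ'.ne' htop, (ENNReal.ofReal_toReal htop).symm⟩
  obtain ⟨R, hR, hV⟩ := exists_tail_le hT hu hv (show 0 < τ / 2 by positivity)
  have hR0 : 0 < R := by linarith
  set m := min 1 (δ / R) with hm
  have hm0 : 0 < m := lt_min one_pos (by positivity)
  have h1 := h.eventually (gt_mem_nhds (show 0 < τ / 2 * m ^ 2 by positivity))
  filter_upwards [h1] with n hn
  have i1 := ((hT n).integrable_min_mul_min u v).const_mul (m ^ 2)⁻¹
  have i2 := ((hT n).integrable_min_sq (R⁻¹ • u)).add ((hT n).integrable_min_sq (R⁻¹ • v))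
  have i3 : Integrable (fun x => (m ^ 2)⁻¹ * (min 1 |⟪u, x⟫| * min 1 |⟪v, x⟫|) +
      (min 1 (⟪R⁻¹ • u, x⟫ ^ 2) + min 1 (⟪R⁻¹ • v, x⟫ ^ 2))) (T n).levyMeasure := i1.add i2
  have hpt (x : E) (hx : δ < |⟪u, x⟫| * |⟪v, x⟫|) : 1 ≤ (m ^ 2)⁻¹ *
      (min 1 |⟪u, x⟫| * min 1 |⟪v, x⟫|) +
        (min 1 (⟪R⁻¹ • u, x⟫ ^ 2) + min 1 (⟪R⁻¹ • v, x⟫ ^ 2)) := by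
    have hmin (w : E) : 0 ≤ min 1 (⟪R⁻¹ • w, x⟫ ^ 2) := by positivity
    have hbig (w : E) (hw : R < |⟪w, x⟫|) : 1 ≤ min 1 (⟪R⁻¹ • w, x⟫ ^ 2) := by
      refine le_min le_rfl ?_
      rw [real_inner_smul_left, ← sq_abs, abs_mul, abs_of_pos (inv_pos.2 hR0)]
      refine one_le_pow₀ ?_
      rw [le_inv_mul_iff₀ hR0]
      linarith
    have h0 : 0 ≤ (m ^ 2)⁻¹ * (min 1 |⟪u, x⟫| * min 1 |⟪v, x⟫|) := by positivity
    by_cases hu' : R < |⟪u, x⟫|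
    · linarith [hbig u hu', hmin v]
    by_cases hv' : R < |⟪v, x⟫|
    · linarith [hbig v hv', hmin u]
    rw [not_lt] at hu' hv'
    have ha : m ≤ min 1 |⟪u, x⟫| := by
      refine min_le_min le_rfl ?_
      rw [div_le_iff₀ hR0]
      nlinarith [abs_nonneg ⟪u, x⟫]
    have hb : m ≤ min 1 |⟪v, x⟫| := by
      refine min_le_min le_rfl ?_
      rw [div_le_iff₀ hR0]
      nlinarith [abs_nonneg ⟪v, x⟫]
    have hab : 1 ≤ (m ^ 2)⁻¹ * (min 1 |⟪u, x⟫| * min 1 |⟪v, x⟫|) := by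
      rw [le_inv_mul_iff₀ (by positivity), mul_one, sq]
      exact mul_le_mul ha hb hm0.le (hm0.le.trans ha)
    linarith [hmin u, hmin v]
  have hSm : MeasurableSet {x : E | δ < |⟪u, x⟫| * |⟪v, x⟫|} :=
    (isOpen_lt (by fun_prop) (by fun_prop)).measurableSet
  calc (T n).levyMeasure {x | δ < |⟪u, x⟫| * |⟪v, x⟫|}
      = ∫⁻ x in {x | δ < |⟪u, x⟫| * |⟪v, x⟫|}, 1 ∂(T n).levyMeasure := by simp
    _ ≤ ∫⁻ x in {x | δ < |⟪u, x⟫| * |⟪v, x⟫|}, ENNReal.ofReal ((m ^ 2)⁻¹ *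
      (min 1 |⟪u, x⟫| * min 1 |⟪v, x⟫|) +
        (min 1 (⟪R⁻¹ • u, x⟫ ^ 2) + min 1 (⟪R⁻¹ • v, x⟫ ^ 2))) ∂(T n).levyMeasure :=
        setLIntegral_mono' hSm fun x hx => by simpa using hpt x hx
    _ ≤ ∫⁻ x, ENNReal.ofReal ((m ^ 2)⁻¹ *
      (min 1 |⟪u, x⟫| * min 1 |⟪v, x⟫|) +
        (min 1 (⟪R⁻¹ • u, x⟫ ^ 2) + min 1 (⟪R⁻¹ • v, x⟫ ^ 2))) ∂(T n).levyMeasure :=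
        setLIntegral_le_lintegral _ _
    _ = ENNReal.ofReal ((m ^ 2)⁻¹ * (T n).crossMoment u v +
        ((T n).truncMoment (R⁻¹ • u) + (T n).truncMoment (R⁻¹ • v))) := by
        rw [← ofReal_integral_eq_lintegral_ofReal i3
          (ae_of_all _ fun x => by positivity)]
        congr 1
        refine (integral_add i1 i2).trans ?_
        rw [integral_const_mul]
        congr 1
        exact integral_add ((hT n).integrable_min_sq (R⁻¹ • u))
          ((hT n).integrable_min_sq (R⁻¹ • v))
    _ ≤ ENNReal.ofReal τ := by
        refine ENNReal.ofReal_le_ofReal ?_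
        have h2 : (m ^ 2)⁻¹ * (T n).crossMoment u v ≤ τ / 2 := by
          rw [inv_mul_le_iff₀ (by positivity)]
          linarith
        linarith [hV n]

/-- Vanishing of the Gaussian covariance and of the mixed moment makes the codifference vanish. -/
theorem tendsto_charFun_add (hT : ∀ n, (T n).IsTripletOf (μ n))
    {a b : ℂ} (hu : ∀ n, charFun (μ n) u = a) (hv : ∀ n, charFun (μ n) v = b)
    (hA : Tendsto (fun n => ⟪u, (T n).gaussianCov v⟫) atTop (𝓝 0))
    (hK : Tendsto (fun n => (T n).crossMoment u v) atTop (𝓝 0)) :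
    Tendsto (fun n => charFun (μ n) (u + v)) atTop (𝓝 (a * b)) := by
  have h1 : Tendsto (fun n => (T n).codifference u v) atTop (𝓝 0) := by
    refine squeeze_zero_norm (fun n => (hT n).norm_codifference_le u v) ?_
    simpa using hA.abs.add (hK.const_mul 4)
  have h2 := ((Complex.continuous_exp.tendsto 0).comp h1).const_mul (a * b)
  rw [Complex.exp_zero, mul_one] at h2
  refine h2.congr fun n => ?_
  rw [(hT n).charFun_add, hu, hv, Function.comp_apply]

theorem min_one_abs_sum_le {ι : Type*} (s : Finset ι) (a : ι → ℝ) :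
    min 1 |∑ i ∈ s, a i| ≤ ∑ i ∈ s, min 1 |a i| := by
  classical
  induction s using Finset.induction_on with
  | empty => simp
  | insert i s hi ih =>
    rw [Finset.sum_insert hi, Finset.sum_insert hi]
    refine le_trans ?_ (add_le_add le_rfl ih)
    have h := abs_add_le (a i) (∑ j ∈ s, a j)
    have h1 := abs_nonneg (a i)
    have h2 := abs_nonneg (∑ j ∈ s, a j)
    rcases min_cases 1 |a i| with ⟨e1, _⟩ | ⟨e1, _⟩ <;>
    rcases min_cases 1 |∑ j ∈ s, a j| with ⟨e2, _⟩ | ⟨e2, _⟩ <;> rw [e1, e2] <;>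
    first
    | exact (min_le_left _ _).trans (by linarith)
    | exact (min_le_right _ _).trans h

theorem crossMoment_sum_le {T : Triplet E} {μ : Measure E} (hT : T.IsTripletOf μ)
    {ι κ : Type*} [Fintype ι] [Fintype κ] (u : ι → E) (v : κ → E) :
    T.crossMoment (∑ i, u i) (∑ k, v k) ≤ ∑ i, ∑ k, T.crossMoment (u i) (v k) := by
  simp only [Triplet.crossMoment]
  simp_rw [← integral_finsetSum Finset.univ fun k _ => hT.integrable_min_mul_min (u _) (v k)]
  rw [← integral_finsetSum Finset.univ fun i _ =>
    integrable_finsetSum Finset.univ fun k _ => hT.integrable_min_mul_min (u i) (v k)]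
  refine integral_mono (hT.integrable_min_mul_min _ _) (integrable_finsetSum Finset.univ fun i _ =>
    integrable_finsetSum Finset.univ fun k _ => hT.integrable_min_mul_min (u i) (v k)) fun x => ?_
  simp only
  rw [sum_inner, sum_inner, ← Finset.sum_mul_sum]
  refine mul_le_mul (min_one_abs_sum_le _ _) (min_one_abs_sum_le _ _) (by positivity)
    (Finset.sum_nonneg fun i _ => by positivity)

/-- Pairwise asymptotic independence of the directions `u i` from the directions `v k` implies
asymptotic independence of their sums. This is where infinite divisibility is essential. -/
theorem tendsto_charFun_sum_add_sum (hT : ∀ n, (T n).IsTripletOf (μ n))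
    {ι κ : Type*} [Fintype ι] [Fintype κ] {u : ι → E} {v : κ → E} {a b : ℂ}
    (hu : ∀ i, ConstMarginal μ (u i)) (hv : ∀ k, ConstMarginal μ (v k))
    (h : ∀ i k, AsymptoticallyIndependent μ (u i) (v k))
    (ha : ∀ n, charFun (μ n) (∑ i, u i) = a) (hb : ∀ n, charFun (μ n) (∑ k, v k) = b) :
    Tendsto (fun n => charFun (μ n) (∑ i, u i + ∑ k, v k)) atTop (𝓝 (a * b)) := by
  refine tendsto_charFun_add hT ha hb ?_ ?_
  · simp only [map_sum, sum_inner, inner_sum]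
    simpa using tendsto_finsetSum Finset.univ fun k _ => tendsto_finsetSum Finset.univ fun i _ =>
      (h i k).tendsto_gaussianCov hT (hu i) (hv k)
  · refine squeeze_zero (fun n => Triplet.IsTripletOf.crossMoment_nonneg _ _ _)
      (fun n => crossMoment_sum_le (hT n) u v) ?_
    simpa using tendsto_finsetSum Finset.univ fun i _ => tendsto_finsetSum Finset.univ fun k _ =>
      (h i k).tendsto_crossMoment hT (hu i) (hv k)

end Asymptotic


/-! ### Characteristic functions of infinitely divisible distributions -/

section CharFun

variable {E : Type*} [NormedAddCommGroup E] [InnerProductSpace ℝ E] [MeasurableSpace E]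
  [BorelSpace E] [FiniteDimensional ℝ E]

theorem charFun_map_sum_pi {ρ : Measure E} [IsProbabilityMeasure ρ] (n : ℕ) (θ : E) :
    charFun ((Measure.pi (fun _ : Fin n => ρ)).map (fun x => ∑ i, x i)) θ = charFun ρ θ ^ n := by
  rw [charFun_apply, integral_map (Measurable.aemeasurable (by fun_prop))
    (Continuous.aestronglyMeasurable (by fun_prop))]
  simp_rw [sum_inner, Complex.ofReal_sum, Finset.sum_mul, Complex.exp_sum]
  rw [integral_fintype_prod_eq_pow (fun x : E => Complex.exp ((⟪x, θ⟫ : ℝ) * Complex.I)),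
    Fintype.card_fin, charFun_apply]

theorem integrable_cexp_inner {ρ : Measure E} [IsFiniteMeasure ρ] (θ : E) :
    Integrable (fun x => Complex.exp ((⟪x, θ⟫ : ℝ) * Complex.I)) ρ :=
  Integrable.of_bound (Continuous.aestronglyMeasurable (by fun_prop)) 1
    (ae_of_all _ fun x => by rw [Complex.norm_exp_ofReal_mul_I])

theorem integrable_cos_inner {ρ : Measure E} [IsFiniteMeasure ρ] (θ : E) :
    Integrable (fun x => Real.cos ⟪x, θ⟫) ρ :=
  Integrable.of_bound (Continuous.aestronglyMeasurable (by fun_prop)) 1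
    (ae_of_all _ fun _ => Real.abs_cos_le_one _)

theorem re_charFun {ρ : Measure E} [IsFiniteMeasure ρ] (θ : E) :
    (charFun ρ θ).re = ∫ x, Real.cos ⟪x, θ⟫ ∂ρ := by
  have h := integral_re (integrable_cexp_inner (ρ := ρ) θ)
  simp only [RCLike.re_eq_complex_re] at h
  rw [charFun_apply, ← h]
  simp [Complex.exp_ofReal_mul_I_re]

theorem one_sub_re_charFun_two_smul_le {ρ : Measure E} [IsProbabilityMeasure ρ] (θ : E) :
    1 - (charFun ρ ((2 : ℝ) • θ)).re ≤ 4 * (1 - (charFun ρ θ).re) := by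
  have h1 (θ : E) : 1 - (charFun ρ θ).re = ∫ x, (1 - Real.cos ⟪x, θ⟫) ∂ρ := by
    rw [re_charFun, integral_sub (integrable_const _) (integrable_cos_inner θ)]
    simp
  rw [h1, h1, ← integral_const_mul]
  refine integral_mono ((integrable_const _).sub (integrable_cos_inner _))
    (((integrable_const _).sub (integrable_cos_inner _)).const_mul _) fun x => ?_
  beta_reduce
  rw [real_inner_smul_right, Real.cos_two_mul]
  nlinarith [sq_nonneg (1 - Real.cos ⟪x, θ⟫)]

/-- The doubling inequality for `|χ|²`, which is the characteristic function of the
symmetrization of `ρ`. -/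
theorem one_sub_norm_sq_charFun_two_smul_le {ρ : Measure E} [IsProbabilityMeasure ρ] (θ : E) :
    1 - ‖charFun ρ ((2 : ℝ) • θ)‖ ^ 2 ≤ 4 * (1 - ‖charFun ρ θ‖ ^ 2) := by
  have : IsProbabilityMeasure (ρ.map fun x : E => (-1 : ℝ) • x) :=
    Measure.isProbabilityMeasure_map (Measurable.aemeasurable (by fun_prop))
  have h (θ : E) : (charFun (ρ ∗ ρ.map fun x : E => (-1 : ℝ) • x) θ).re = ‖charFun ρ θ‖ ^ 2 := by
    rw [charFun_conv, charFun_map_smul, neg_one_smul, charFun_neg, Complex.mul_conj,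
      Complex.ofReal_re, Complex.normSq_eq_norm_sq]
  rw [← h, ← h]
  exact one_sub_re_charFun_two_smul_le θ

/-- The characteristic function of a distribution with `n`-th convolution roots for every `n`
has no zeros: by the doubling inequality for a root of high order, the set of non-zeros is stable
under `θ ↦ 2 θ`, and it contains a neighbourhood of the origin. -/
theorem charFun_ne_zero_of_roots {μ : Measure E} [IsProbabilityMeasure μ]
    (h : ∀ n : ℕ, 1 ≤ n → ∃ ρ : Measure E, IsProbabilityMeasure ρ ∧
      ∀ θ, charFun ρ θ ^ n = charFun μ θ) (θ : E) : charFun μ θ ≠ 0 := by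
  have hstep (θ : E) (hθ : charFun μ θ ≠ 0) : charFun μ ((2 : ℝ) • θ) ≠ 0 := by
    have hpos : 0 < ‖charFun μ θ‖ ^ 2 := by positivity
    obtain ⟨n, hn, hn1⟩ := (((tendsto_pow_atTop_nhds_zero_of_lt_one (r := (3 / 4 : ℝ))
      (by norm_num) (by norm_num)).eventually (gt_mem_nhds hpos)).and
        (eventually_ge_atTop 1)).exists
    obtain ⟨ρ, hρ, hroot⟩ := h n hn1
    have h1 : 3 / 4 < ‖charFun ρ θ‖ ^ 2 := by
      by_contra hcon
      have := pow_le_pow_left₀ (sq_nonneg _) (not_lt.1 hcon) n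
      rw [← pow_mul, mul_comm, pow_mul, ← norm_pow, hroot] at this
      linarith
    have h2 := one_sub_norm_sq_charFun_two_smul_le (ρ := ρ) θ
    rw [← hroot]
    refine pow_ne_zero n fun h0 => ?_
    rw [h0] at h2
    norm_num at h2
    linarith
  have hcont : Tendsto (fun k : ℕ => charFun μ ((2⁻¹ ^ k : ℝ) • θ)) atTop (𝓝 1) := by
    have h1 : Tendsto (fun k : ℕ => (2⁻¹ ^ k : ℝ) • θ) atTop (𝓝 0) := by
      have := (tendsto_pow_atTop_nhds_zero_of_lt_one (r := (2⁻¹ : ℝ))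
        (by norm_num) (by norm_num)).smul_const θ
      rwa [zero_smul] at this
    have h2 := ((continuous_charFun (μ := μ)).tendsto 0).comp h1
    simpa [Function.comp_def] using h2
  obtain ⟨k, hk⟩ := (hcont.eventually_ne one_ne_zero).exists
  have hind (j : ℕ) : charFun μ ((2 : ℝ) ^ j • (2⁻¹ ^ k : ℝ) • θ) ≠ 0 := by
    induction j with
    | zero => simpa using hk
    | succ j ih =>
      rw [pow_succ', mul_smul]
      exact hstep _ ih
  have h3 := hind k
  rwa [smul_smul, ← mul_pow, mul_inv_cancel₀ two_ne_zero, one_pow, one_smul] at h3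

/-- The distinguished logarithm of a nonvanishing characteristic function. -/
theorem existsUnique_log_charFun {μ : Measure E} [IsProbabilityMeasure μ]
    (h : ∀ θ, charFun μ θ ≠ 0) :
    ∃! ψ : C(E, ℂ), ψ 0 = 0 ∧ Complex.exp ∘ ψ = charFun μ :=
  Complex.isCoveringMapOn_exp.existsUnique_continuousMap_lifts
    ⟨charFun μ, continuous_charFun⟩ (a₀ := (0 : E)) (e₀ := (0 : ℂ)) (by simp) h

/-- The convolution roots of an infinitely divisible distribution have the characteristic
functions `exp (ψ / n)`, where `ψ` is the distinguished logarithm. -/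
theorem exists_log_charFun {μ : Measure E} [IsProbabilityMeasure μ]
    (h : IsInfinitelyDivisible μ) :
    ∃ (ψ : C(E, ℂ)) (ρ : ℕ → Measure E), ψ 0 = 0 ∧ (∀ θ, charFun μ θ = Complex.exp (ψ θ)) ∧
      ∀ n, IsProbabilityMeasure (ρ n) ∧
        ∀ θ, charFun (ρ n) θ = Complex.exp (ψ θ / ((n : ℂ) + 1)) := by
  have hroots : ∀ n : ℕ, 1 ≤ n → ∃ ρ : Measure E, IsProbabilityMeasure ρ ∧
      ∀ θ, charFun ρ θ ^ n = charFun μ θ := by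
    intro n hn
    obtain ⟨ρ, hρ, rfl⟩ := h n hn
    exact ⟨ρ, hρ, fun θ => (charFun_map_sum_pi n θ).symm⟩
  have hne := charFun_ne_zero_of_roots hroots
  obtain ⟨ψ, ⟨hψ0, hψ⟩, huniq⟩ := existsUnique_log_charFun hne
  choose! ρ hρ hroot using hroots
  refine ⟨ψ, fun n => ρ (n + 1), hψ0, fun θ => (congrFun hψ θ).symm,
    fun n => ⟨hρ (n + 1) (by omega), fun θ => ?_⟩⟩
  have := hρ (n + 1) (by omega)
  have hroot := hroot (n + 1) (by omega)
  obtain ⟨φ, ⟨hφ0, hφ⟩, -⟩ := existsUnique_log_charFun (μ := ρ (n + 1)) fun θ h0 =>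
    hne θ (by rw [← hroot, h0, zero_pow (by omega)])
  have h1 : ((n : ℂ) + 1) • φ = ψ := by
    refine huniq _ ⟨by simp [hφ0], funext fun θ => ?_⟩
    rw [← hroot, ← hφ, Function.comp_apply, Function.comp_apply, ← Complex.exp_nat_mul]
    simp
  have hn : ((n : ℂ) + 1) ≠ 0 := by exact_mod_cast Nat.succ_ne_zero n
  rw [← hφ, ← h1]
  simp [hn]

theorem norm_mul_exp_div_sub_one_le {z : ℂ} (n : ℕ) (hz : ‖Complex.exp (z / ((n : ℂ) + 1))‖ ≤ 1) :
    ((n : ℝ) + 1) * ‖Complex.exp (z / ((n : ℂ) + 1)) - 1‖ ≤ 2 * ‖z‖ := by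
  have hn : (0 : ℝ) < (n : ℝ) + 1 := by positivity
  have hnorm : ‖z / ((n : ℂ) + 1)‖ = ‖z‖ / ((n : ℝ) + 1) := by
    rw [norm_div]
    congr 1
    exact_mod_cast Complex.norm_natCast (n + 1)
  rcases le_total ‖z / ((n : ℂ) + 1)‖ 1 with h | h
  · have h1 := Complex.norm_exp_sub_one_le h
    rw [hnorm] at h1
    calc ((n : ℝ) + 1) * ‖Complex.exp (z / ((n : ℂ) + 1)) - 1‖
        ≤ ((n : ℝ) + 1) * (2 * (‖z‖ / ((n : ℝ) + 1))) := mul_le_mul_of_nonneg_left h1 hn.le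
      _ = 2 * ‖z‖ := by field_simp
  · rw [hnorm, one_le_div hn] at h
    have h1 : ‖Complex.exp (z / ((n : ℂ) + 1)) - 1‖ ≤ 2 := by
      refine (norm_sub_le _ _).trans ?_
      rw [norm_one]
      linarith
    nlinarith

theorem tendsto_mul_exp_div_sub_one (z : ℂ) :
    Tendsto (fun n : ℕ => ((n : ℂ) + 1) * (Complex.exp (z / ((n : ℂ) + 1)) - 1)) atTop (𝓝 z) := by
  rw [tendsto_iff_norm_sub_tendsto_zero]
  have hlim : Tendsto (fun n : ℕ => ‖z‖ ^ 2 * (1 / ((n : ℝ) + 1))) atTop (𝓝 0) := by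
    simpa using (tendsto_one_div_add_atTop_nhds_zero_nat (𝕜 := ℝ)).const_mul (‖z‖ ^ 2)
  refine squeeze_zero' (Eventually.of_forall fun n => norm_nonneg _) ?_ hlim
  filter_upwards [eventually_ge_atTop ⌈‖z‖⌉₊] with n hn
  have hzn : ‖z‖ ≤ (n : ℝ) + 1 := (Nat.ceil_le.1 hn).trans (by linarith)
  have hn0 : (0 : ℝ) < (n : ℝ) + 1 := by positivity
  have hnorm1 : ‖(n : ℂ) + 1‖ = (n : ℝ) + 1 := by exact_mod_cast Complex.norm_natCast (n + 1)
  have hnc : ((n : ℂ) + 1) ≠ 0 := by exact_mod_cast Nat.succ_ne_zero n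
  have h1 := Complex.norm_exp_sub_one_sub_id_le (x := z / ((n : ℂ) + 1))
    (by rw [norm_div, hnorm1, div_le_one hn0]; exact hzn)
  have h2 : ((n : ℂ) + 1) * (Complex.exp (z / ((n : ℂ) + 1)) - 1) - z =
      ((n : ℂ) + 1) * (Complex.exp (z / ((n : ℂ) + 1)) - 1 - z / ((n : ℂ) + 1)) := by
    field_simp
  rw [h2, norm_mul, hnorm1]
  rw [norm_div, hnorm1] at h1
  calc ((n : ℝ) + 1) * ‖Complex.exp (z / ((n : ℂ) + 1)) - 1 - z / ((n : ℂ) + 1)‖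
      ≤ ((n : ℝ) + 1) * (‖z‖ / ((n : ℝ) + 1)) ^ 2 := mul_le_mul_of_nonneg_left h1 hn0.le
    _ = ‖z‖ ^ 2 * (1 / ((n : ℝ) + 1)) := by field_simp

/-- The measures `(n + 1) ρₙ`, with `ρₙ` the convolution roots, have uniformly bounded truncated
second moments at every scale `r⁻¹`, with a bound given by the size of the logarithm `ψ` of the
characteristic function near the origin. -/
theorem lintegral_min_one_norm_sq_le {ψ : E → ℂ} {ρ : Measure E} [IsProbabilityMeasure ρ] {n : ℕ}
    (hρ : ∀ θ, charFun ρ θ = Complex.exp (ψ θ / ((n : ℂ) + 1))) {r M : ℝ} (hr : 0 < r)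
    (hM : ∀ θ, ‖θ‖ ≤ r → ‖ψ θ‖ ≤ M) :
    ∫⁻ x, ENNReal.ofReal (min 1 ((r * ‖x‖) ^ 2)) ∂((n + 1 : ℝ).toNNReal • ρ) ≤
      ENNReal.ofReal (30 * Module.finrank ℝ E * M) := by
  set b := stdOrthonormalBasis ℝ E
  have hcoord (i : Fin (Module.finrank ℝ E)) :
      ∫⁻ x, ENNReal.ofReal (min 1 (⟪r • b i, x⟫ ^ 2)) ∂((n + 1 : ℝ).toNNReal • ρ) ≤
        15 * ENNReal.ofReal (2 * M) := by
    refine lintegral_min_one_sq_le (Continuous.measurable (by fun_prop)) fun c hc => ?_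
    have hle : ‖(c * r) • b i‖ ≤ r := by
      rw [norm_smul, b.orthonormal.1 i, mul_one, Real.norm_of_nonneg (mul_nonneg hc.1 hr.le)]
      exact mul_le_of_le_one_left hr.le hc.2
    have hcos (x : E) : c * ⟪r • b i, x⟫ = ⟪x, (c * r) • b i⟫ := by
      rw [real_inner_smul_left, real_inner_smul_right, real_inner_comm, mul_assoc]
    simp_rw [hcos]
    have hint : Integrable (fun x => 1 - Real.cos ⟪x, (c * r) • b i⟫)
        ((n + 1 : ℝ).toNNReal • ρ) := (integrable_const _).sub (integrable_cos_inner _)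
    rw [← ofReal_integral_eq_lintegral_ofReal hint
      (ae_of_all _ fun x => by simpa using Real.cos_le_one _)]
    refine ENNReal.ofReal_le_ofReal ?_
    rw [integral_smul_nnreal_measure, integral_sub (integrable_const _) (integrable_cos_inner _),
      ← re_charFun]
    have h1 := norm_mul_exp_div_sub_one_le (z := ψ ((c * r) • b i)) n
      (by rw [← hρ]; exact norm_charFun_le_one _)
    rw [← hρ] at h1
    have h2 := Complex.abs_re_le_norm (charFun ρ ((c * r) • b i) - 1)
    have h3 := (neg_le_abs _).trans h2
    have h4 := hM _ hle
    have hn : (0 : ℝ) ≤ (n : ℝ) + 1 := by positivity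
    have h5 := mul_le_mul_of_nonneg_left h3 hn
    simp only [Complex.sub_re, Complex.one_re] at h5
    rw [NNReal.smul_def, Real.coe_toNNReal _ hn, smul_eq_mul]
    simp only [integral_const, probReal_univ, smul_eq_mul, mul_one]
    linarith
  have hpt (x : E) : ENNReal.ofReal (min 1 ((r * ‖x‖) ^ 2)) ≤
      ∑ i, ENNReal.ofReal (min 1 (⟪r • b i, x⟫ ^ 2)) := by
    rw [← ENNReal.ofReal_sum_of_nonneg fun i _ => by positivity]
    refine ENNReal.ofReal_le_ofReal ?_
    have hsum : (r * ‖x‖) ^ 2 = ∑ i, ⟪r • b i, x⟫ ^ 2 := by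
      simp_rw [real_inner_smul_left, mul_pow, ← Finset.mul_sum]
      rw [← b.sum_sq_norm_inner_right x]
      simp
    by_cases h : ∃ i, 1 ≤ ⟪r • b i, x⟫ ^ 2
    · obtain ⟨i, hi⟩ := h
      calc min 1 ((r * ‖x‖) ^ 2) ≤ 1 := min_le_left _ _
        _ = min 1 (⟪r • b i, x⟫ ^ 2) := (min_eq_left hi).symm
        _ ≤ ∑ i, min 1 (⟪r • b i, x⟫ ^ 2) :=
          Finset.single_le_sum (f := fun i => min 1 (⟪r • b i, x⟫ ^ 2))
            (fun i _ => by positivity) (Finset.mem_univ i)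
    · push Not at h
      rw [hsum]
      refine (min_le_right _ _).trans (Finset.sum_le_sum fun i _ => ?_)
      rw [min_eq_right (h i).le]
  calc ∫⁻ x, ENNReal.ofReal (min 1 ((r * ‖x‖) ^ 2)) ∂((n + 1 : ℝ).toNNReal • ρ)
      ≤ ∫⁻ x, ∑ i, ENNReal.ofReal (min 1 (⟪r • b i, x⟫ ^ 2)) ∂((n + 1 : ℝ).toNNReal • ρ) :=
        lintegral_mono hpt
    _ = ∑ i, ∫⁻ x, ENNReal.ofReal (min 1 (⟪r • b i, x⟫ ^ 2)) ∂((n + 1 : ℝ).toNNReal • ρ) :=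
        lintegral_finsetSum _ fun i _ =>
          ENNReal.measurable_ofReal.comp (Continuous.measurable (by fun_prop))
    _ ≤ ∑ _i : Fin (Module.finrank ℝ E), 15 * ENNReal.ofReal (2 * M) :=
        Finset.sum_le_sum fun i _ => hcoord i
    _ = ENNReal.ofReal (30 * Module.finrank ℝ E * M) := by
        have hM0 : 0 ≤ M := (norm_nonneg _).trans (hM 0 (by simpa using hr.le))
        rw [Finset.sum_const, Finset.card_univ, Fintype.card_fin, nsmul_eq_mul,
          show (15 : ENNReal) = ENNReal.ofReal 15 by simp, ← ENNReal.ofReal_natCast,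
          ← ENNReal.ofReal_mul (by norm_num), ← ENNReal.ofReal_mul (by positivity)]
        congr 1
        ring

end CharFun


/-! ### The Lévy–Khintchine representation -/

/-- The function `(exp(iy) - 1 - iy) / y²`, extended continuously by `-1/2` at `y = 0`. -/
noncomputable def expRemainder (y : ℝ) : ℂ :=
  if y = 0 then -(1 / 2) else (Complex.exp (Complex.I * y) - 1 - Complex.I * y) / (y : ℂ) ^ 2

theorem sq_mul_expRemainder (y : ℝ) :
    (y : ℂ) ^ 2 * expRemainder y = Complex.exp (Complex.I * y) - 1 - Complex.I * y := by
  by_cases hy : y = 0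
  · simp [hy]
  · have : (y : ℂ) ≠ 0 := by exact_mod_cast hy
    rw [expRemainder, if_neg hy]
    field_simp

theorem norm_expRemainder_le (y : ℝ) : ‖expRemainder y‖ ≤ 3 := by
  by_cases hy : y = 0
  · rw [expRemainder, if_pos hy]
    norm_num
  · have hy2 : 0 < y ^ 2 := by positivity
    rw [expRemainder, if_neg hy, norm_div, norm_pow, Complex.norm_real, Real.norm_eq_abs, sq_abs,
      div_le_iff₀ hy2]
    exact norm_exp_I_mul_sub_one_sub_le y

theorem continuous_expRemainder : Continuous expRemainder := by
  rw [continuous_iff_continuousAt]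
  intro y
  by_cases hy : y = 0
  · subst hy
    rw [Metric.continuousAt_iff]
    intro ε hε
    refine ⟨min 1 ε, lt_min one_pos hε, fun {y} hlt => ?_⟩
    rw [Real.dist_eq, sub_zero, lt_min_iff] at hlt
    have h0 : expRemainder 0 = -(1 / 2) := if_pos rfl
    rw [dist_eq_norm, h0]
    by_cases hy : y = 0
    · simpa [hy, h0] using hε
    refine lt_of_le_of_lt ?_ hlt.2
    have hyc : (y : ℂ) ≠ 0 := by exact_mod_cast hy
    have hb := Complex.exp_bound (x := Complex.I * y) (by simpa using hlt.1.le)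
      (show 0 < 3 by norm_num)
    have e : expRemainder y - -(1 / 2) = (Complex.exp (Complex.I * y) -
        ∑ m ∈ Finset.range 3, (Complex.I * y) ^ m / (m.factorial : ℂ)) / (y : ℂ) ^ 2 := by
      rw [expRemainder, if_neg hy]
      simp only [Finset.sum_range_succ, Finset.sum_range_zero, mul_pow, Complex.I_sq]
      field_simp
      simp
      ring
    have hn : ‖Complex.I * (y : ℂ)‖ = |y| := by simp
    rw [hn] at hb
    have hy2 : 0 < |y| ^ 2 := by positivity
    rw [e, norm_div, norm_pow, Complex.norm_real, Real.norm_eq_abs, div_le_iff₀ hy2]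
    refine hb.trans ?_
    have h3 : 0 ≤ |y| ^ 3 := by positivity
    have h4 : ((Nat.succ 3 : ℕ) : ℝ) * (((Nat.factorial 3 : ℕ) : ℝ) * ((3 : ℕ) : ℝ))⁻¹ ≤ 1 := by
      norm_num [Nat.factorial]
    exact (mul_le_mul_of_nonneg_left h4 h3).trans (by rw [mul_one, pow_succ' _ 2])
  · have h : ContinuousAt (fun y : ℝ =>
        (Complex.exp (Complex.I * y) - 1 - Complex.I * y) / (y : ℂ) ^ 2) y :=
      ContinuousAt.div (by fun_prop) (by fun_prop) (by simpa using hy)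
    refine h.congr ?_
    filter_upwards [isOpen_ne.mem_nhds hy] with z hz
    exact (if_neg hz).symm

section LevyKhintchine

variable {E : Type*} [NormedAddCommGroup E] [InnerProductSpace ℝ E]

/-- The space `ℝ × {‖s‖ ≤ 1}` of polar coordinates `(r, s)` of the point `r • s`. Here `r` may
have any sign and `s` may lie inside the unit ball. -/
abbrev PolarSpace (E : Type*) [NormedAddCommGroup E] : Type _ := ℝ × Metric.closedBall (0 : E) 1

/-- The point with given polar coordinates. -/
def PolarSpace.toPoint (y : PolarSpace E) : E := y.1 • (y.2 : E)

/-- Polar coordinates of a point, with direction `0` for the origin. -/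
noncomputable def polar (x : E) : PolarSpace E :=
  (‖x‖, ⟨‖x‖⁻¹ • x, by
    rw [mem_closedBall_zero_iff, norm_smul, norm_inv, norm_norm]
    exact inv_mul_le_one⟩)

/-- The Lévy–Khintchine kernel in polar coordinates `x = r • s`, relative to the weight
`r² / (1 + r²)`: it is the continuous extension of
`(exp(i⟪θ, x⟫) - 1 - i⟪θ, x⟫ / (1 + r²)) (1 + r²) / r²`. At `r = 0` it takes the value
`-⟪θ, s⟫² / 2`, which depends on the direction `s`; this is why polar coordinates are used. -/
noncomputable def polarKernel (θ : E) (y : PolarSpace E) : ℂ :=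
  ((⟪θ, y.2⟫ : ℝ) : ℂ) ^ 2 * expRemainder (y.1 * ⟪θ, y.2⟫) +
    (Complex.exp (Complex.I * ((y.1 * ⟪θ, y.2⟫ : ℝ) : ℂ)) - 1)

theorem continuous_polarKernel (θ : E) : Continuous (polarKernel θ) := by
  have := continuous_expRemainder
  unfold polarKernel
  fun_prop

theorem norm_polarKernel_le (θ : E) (y : PolarSpace E) :
    ‖polarKernel θ y‖ ≤ 3 * ‖θ‖ ^ 2 + 2 := by
  have h1 := abs_real_inner_le_norm θ y.2
  have h2 : ‖(y.2 : E)‖ ≤ 1 := mem_closedBall_zero_iff.1 y.2.2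
  have h3 : ⟪θ, y.2⟫ ^ 2 ≤ ‖θ‖ ^ 2 := by
    rw [← sq_abs]
    refine pow_le_pow_left₀ (abs_nonneg _) (h1.trans ?_) 2
    exact mul_le_of_le_one_right (norm_nonneg _) h2
  refine (norm_add_le _ _).trans (add_le_add ?_ ?_)
  · rw [norm_mul, norm_pow, Complex.norm_real, Real.norm_eq_abs, sq_abs, mul_comm]
    exact mul_le_mul (norm_expRemainder_le _) h3 (sq_nonneg _) (by norm_num)
  · refine (norm_exp_I_mul_sub_one_le_min _).trans ?_
    linarith [min_le_left 1 |y.1 * ⟪θ, y.2⟫|]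

theorem sq_mul_polarKernel (θ : E) (y : PolarSpace E) :
    (y.1 : ℂ) ^ 2 * polarKernel θ y = (1 + (y.1 : ℂ) ^ 2) *
      (Complex.exp (Complex.I * ((⟪θ, y.toPoint⟫ : ℝ) : ℂ)) - 1) -
        Complex.I * ((⟪θ, y.toPoint⟫ : ℝ) : ℂ) := by
  have h := sq_mul_expRemainder (y.1 * ⟪θ, y.2⟫)
  rw [PolarSpace.toPoint, real_inner_smul_right, polarKernel, mul_add, ← mul_assoc, ← mul_pow,
    ← Complex.ofReal_mul, h]
  ring

variable [MeasurableSpace E] [BorelSpace E] [FiniteDimensional ℝ E]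

theorem measurable_polar : Measurable (polar : E → PolarSpace E) := by
  refine Measurable.prodMk (by fun_prop) (Measurable.subtype_mk (by fun_prop))

theorem continuous_toPoint : Continuous (PolarSpace.toPoint : PolarSpace E → E) := by
  unfold PolarSpace.toPoint
  fun_prop

/-- The image in polar coordinates of the measure `‖x‖² / (1 + ‖x‖²) ν(dx)`. -/
noncomputable def polarMeasure (ν : Measure E) : Measure (PolarSpace E) :=
  (ν.withDensity fun x => ENNReal.ofReal (‖x‖ ^ 2 / (1 + ‖x‖ ^ 2))).map polar

theorem measurable_weight :
    Measurable fun x : E => ENNReal.ofReal (‖x‖ ^ 2 / (1 + ‖x‖ ^ 2)) :=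
  ENNReal.measurable_ofReal.comp (by fun_prop)

theorem integral_polarKernel_polarMeasure {ν : Measure E} [IsFiniteMeasure ν] (θ : E) :
    ∫ y, polarKernel θ y ∂(polarMeasure ν) = (∫ x, (Complex.exp ((⟪x, θ⟫ : ℝ) * Complex.I) - 1) ∂ν)
      - Complex.I * ((⟪∫ x, (1 + ‖x‖ ^ 2)⁻¹ • x ∂ν, θ⟫ : ℝ) : ℂ) := by
  have hb : Integrable (fun x : E => (1 + ‖x‖ ^ 2)⁻¹ • x) ν := by
    refine Integrable.of_bound (Measurable.aestronglyMeasurable (by fun_prop)) 1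
      (ae_of_all _ fun x => ?_)
    rw [norm_smul, norm_inv, Real.norm_of_nonneg (by positivity), inv_mul_le_iff₀ (by positivity)]
    nlinarith [sq_nonneg (‖x‖ - 1)]
  have hinner : ((⟪∫ x, (1 + ‖x‖ ^ 2)⁻¹ • x ∂ν, θ⟫ : ℝ) : ℂ) =
      ∫ x, ((⟪θ, (1 + ‖x‖ ^ 2)⁻¹ • x⟫ : ℝ) : ℂ) ∂ν := by
    rw [integral_complex_ofReal, real_inner_comm, integral_inner hb θ]
  have hinner_int : Integrable (fun x => ((⟪θ, (1 + ‖x‖ ^ 2)⁻¹ • x⟫ : ℝ) : ℂ)) ν :=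
    (hb.const_inner θ).ofReal
  have hexp_int : Integrable (fun x => Complex.exp ((⟪x, θ⟫ : ℝ) * Complex.I) - 1) ν :=
    (integrable_cexp_inner θ).sub (integrable_const _)
  rw [polarMeasure, integral_map measurable_polar.aemeasurable
    (continuous_polarKernel θ).aestronglyMeasurable,
    integral_withDensity_eq_integral_toReal_smul measurable_weight
      (ae_of_all _ fun x => ENNReal.ofReal_lt_top), hinner, ← integral_const_mul,
    ← integral_sub hexp_int (hinner_int.const_mul _)]
  refine integral_congr_ae (ae_of_all _ fun x => ?_)
  have hx : (polar x).toPoint = x := by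
    rcases eq_or_ne x 0 with rfl | hx
    · simp [polar, PolarSpace.toPoint]
    · simp [polar, PolarSpace.toPoint, smul_smul, norm_ne_zero_iff.2 hx]
  have h := sq_mul_polarKernel θ (polar x)
  rw [hx] at h
  have h1 : (polar x).1 = ‖x‖ := rfl
  rw [h1] at h
  have hpos : (0 : ℝ) < 1 + ‖x‖ ^ 2 := by positivity
  have hne : (1 + (‖x‖ : ℂ) ^ 2) ≠ 0 := by exact_mod_cast hpos.ne'
  simp only
  rw [ENNReal.toReal_ofReal (by positivity), Complex.real_smul, real_inner_smul_right,
    real_inner_comm θ x]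
  push_cast
  rw [div_mul_eq_mul_div, h]
  field_simp

/-- The canonical measure representation of infinitely divisible distributions: the finite measure
is a weak limit of the images of `‖x‖² / (1 + ‖x‖²) (n + 1) ρₙ(dx)` in polar coordinates, where
`ρₙ` are the convolution roots. -/
theorem exists_polar_representation {μ : Measure E} [IsProbabilityMeasure μ]
    (h : IsInfinitelyDivisible μ) :
    ∃ (κ : Measure (PolarSpace E)) (b : E), IsFiniteMeasure κ ∧
      ∀ θ, charFun μ θ =
        Complex.exp (Complex.I * ((⟪b, θ⟫ : ℝ) : ℂ) + ∫ y, polarKernel θ y ∂κ) := by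
  obtain ⟨ψ, ρ, hψ0, hψ, hρ⟩ := exists_log_charFun h
  have hprob n : IsProbabilityMeasure (ρ n) := (hρ n).1
  set ν : ℕ → Measure E := fun n => (n + 1 : ℝ).toNNReal • ρ n with hν
  have hle (n : ℕ) (B : Set (PolarSpace E)) (hB : MeasurableSet B) {r M : ℝ} (hr : 0 < r)
      (hM : ∀ θ, ‖θ‖ ≤ r → ‖ψ θ‖ ≤ M)
      (hBr : ∀ x : E, polar x ∈ B → ‖x‖ ^ 2 / (1 + ‖x‖ ^ 2) ≤ min 1 ((r * ‖x‖) ^ 2)) :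
      polarMeasure (ν n) B ≤ ENNReal.ofReal (30 * Module.finrank ℝ E * M) := by
    rw [polarMeasure, Measure.map_apply measurable_polar hB,
      withDensity_apply _ (measurable_polar hB)]
    exact ((setLIntegral_mono' (measurable_polar hB) fun x hx =>
      ENNReal.ofReal_le_ofReal (hBr x hx)).trans (setLIntegral_le_lintegral _ _)).trans
        (lintegral_min_one_norm_sq_le (hρ n).2 hr hM)
  obtain ⟨M₀, hM₀⟩ := (isCompact_closedBall (0 : E) 1).exists_bound_of_continuousOn
    ψ.continuous.continuousOn
  have hmass (n : ℕ) : polarMeasure (ν n) Set.univ ≤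
      ENNReal.ofReal (30 * Module.finrank ℝ E * M₀) := by
    refine hle n _ MeasurableSet.univ one_pos (fun θ hθ => hM₀ θ (by simpa using hθ)) fun x _ => ?_
    rw [one_mul]
    refine le_min ?_ ?_
    · rw [div_le_one (by positivity)]
      linarith
    · exact div_le_self (by positivity) (by nlinarith [sq_nonneg ‖x‖])
  have hfin n : IsFiniteMeasure (polarMeasure (ν n)) :=
    ⟨(hmass n).trans_lt ENNReal.ofReal_lt_top⟩
  have hr (j : ℕ) : ∃ r : ℝ, 0 < r ∧ ∀ θ, ‖θ‖ ≤ r → ‖ψ θ‖ ≤ 1 / ((j : ℝ) + 1) := by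
    have h1 : Tendsto (fun θ => ‖ψ θ‖) (𝓝 0) (𝓝 0) := by
      have := ψ.continuous.norm.tendsto 0
      rwa [hψ0, norm_zero] at this
    obtain ⟨r, hr, hball⟩ := Metric.nhds_basis_closedBall.eventually_iff.1
      (h1.eventually (ge_mem_nhds (show (0 : ℝ) < 1 / ((j : ℝ) + 1) by positivity)))
    exact ⟨r, hr, fun θ hθ => hball (by simpa using hθ)⟩
  choose r hr hrψ using hr
  set K : ℕ → Set (PolarSpace E) := fun j => Set.Icc (-(r j)⁻¹) (r j)⁻¹ ×ˢ Set.univ with hK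
  have hKc j : IsCompact (K j) := isCompact_Icc.prod isCompact_univ
  have htight (n j : ℕ) : polarMeasure (ν n) (K j)ᶜ ≤
      ENNReal.ofReal (30 * Module.finrank ℝ E * (1 / ((j : ℝ) + 1))) := by
    refine hle n _ (hKc j).measurableSet.compl (hr j) (hrψ j) fun x hx => ?_
    have hx1 : (r j)⁻¹ < ‖x‖ := by
      by_contra hcon
      refine hx ⟨⟨?_, not_lt.1 hcon⟩, Set.mem_univ _⟩
      have := inv_pos.2 (hr j)
      have := norm_nonneg x
      simp only [polar]
      linarith
    have hx2 : 1 ≤ r j * ‖x‖ := by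
      rw [inv_lt_iff_one_lt_mul₀' (hr j)] at hx1
      exact hx1.le
    rw [min_eq_left (one_le_pow₀ hx2), div_le_one (by positivity)]
    linarith
  set κs : ℕ → FiniteMeasure (PolarSpace E) := fun n => ⟨polarMeasure (ν n), hfin n⟩ with hκs
  have hu : Tendsto (fun j : ℕ => Real.toNNReal (30 * Module.finrank ℝ E * (1 / ((j : ℝ) + 1))))
      atTop (𝓝 0) := by
    have h1 := (tendsto_one_div_add_atTop_nhds_zero_nat (𝕜 := ℝ)).const_mul
      (30 * (Module.finrank ℝ E : ℝ))
    rw [mul_zero] at h1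
    simpa using tendsto_real_toNNReal h1
  have hcompact := isCompact_setOfPred_finiteMeasure_mass_le_compl_isCompact_le
    (Real.toNNReal (30 * Module.finrank ℝ E * M₀)) hu hKc (Or.inl inferInstance)
  -- Prokhorov's theorem is applied along an ultrafilter instead of a subsequence.
  obtain ⟨κ, -, hκ⟩ := hcompact.ultrafilter_le_nhds ((hyperfilter ℕ).map κs) (by
    refine le_principal_iff.2 (Filter.mem_map.2 (Eventually.of_forall fun n => ⟨?_, fun j => ?_⟩))
    · rw [← ENNReal.coe_le_coe, FiniteMeasure.ennreal_mass]
      exact hmass n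
    · rw [← ENNReal.coe_le_coe, FiniteMeasure.ennreal_coeFn_eq_coeFn_toMeasure]
      exact htight n j)
  have hlim : Tendsto κs (hyperfilter ℕ) (𝓝 κ) := hκ
  rw [FiniteMeasure.tendsto_iff_forall_integral_rclike_tendsto ℂ] at hlim
  set b : ℕ → E := fun n => ∫ x, (1 + ‖x‖ ^ 2)⁻¹ • x ∂(ν n) with hb
  have hkernel (θ : E) : Tendsto (fun n => ∫ y, polarKernel θ y ∂(polarMeasure (ν n)))
      (hyperfilter ℕ) (𝓝 (∫ y, polarKernel θ y ∂(κ : Measure (PolarSpace E)))) :=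
    hlim (BoundedContinuousFunction.ofNormedAddCommGroup (polarKernel θ)
      (continuous_polarKernel θ) _ (norm_polarKernel_le θ))
  have hexp (θ : E) (n : ℕ) : ∫ x, (Complex.exp ((⟪x, θ⟫ : ℝ) * Complex.I) - 1) ∂(ν n) =
      ((n : ℂ) + 1) * (Complex.exp (ψ θ / ((n : ℂ) + 1)) - 1) := by
    have hn : (0 : ℝ) ≤ (n : ℝ) + 1 := by positivity
    rw [hν, integral_smul_nnreal_measure, integral_sub (integrable_cexp_inner θ)
      (integrable_const _), ← charFun_apply, (hρ n).2, NNReal.smul_def, Real.coe_toNNReal _ hn]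
    simp
  have hdrift (θ : E) : Tendsto (fun n => Complex.I * ((⟪b n, θ⟫ : ℝ) : ℂ)) (hyperfilter ℕ)
      (𝓝 (ψ θ - ∫ y, polarKernel θ y ∂(κ : Measure (PolarSpace E)))) := by
    have h1 := ((tendsto_mul_exp_div_sub_one (ψ θ)).mono_left Nat.hyperfilter_le_atTop).sub
      (hkernel θ)
    refine h1.congr fun n => ?_
    rw [integral_polarKernel_polarMeasure, hexp]
    ring
  have hreal (θ : E) : Tendsto (fun n => ⟪b n, θ⟫) (hyperfilter ℕ)
      (𝓝 (ψ θ - ∫ y, polarKernel θ y ∂(κ : Measure (PolarSpace E))).im) := by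
    have := (Complex.continuous_im.tendsto _).comp (hdrift θ)
    refine this.congr fun n => ?_
    simp
  -- The limit of the linear functionals `⟪b n, ·⟫` is linear, hence given by a vector.
  set e := stdOrthonormalBasis ℝ E
  set b₀ : E := ∑ i, (ψ (e i) - ∫ y, polarKernel (e i) y ∂(κ : Measure (PolarSpace E))).im • e i
    with hb₀
  have hb₀lim (θ : E) : Tendsto (fun n => ⟪b n, θ⟫) (hyperfilter ℕ) (𝓝 ⟪b₀, θ⟫) := by
    have h1 := tendsto_finsetSum Finset.univ fun i _ => (hreal (e i)).mul_const ⟪e i, θ⟫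
    have h2 : ⟪b₀, θ⟫ = ∑ i, (ψ (e i) -
        ∫ y, polarKernel (e i) y ∂(κ : Measure (PolarSpace E))).im * ⟪e i, θ⟫ := by
      rw [hb₀, sum_inner]
      simp_rw [real_inner_smul_left]
    rw [h2]
    refine h1.congr fun n => ?_
    exact e.sum_inner_mul_inner (b n) θ
  refine ⟨κ, b₀, inferInstance, fun θ => ?_⟩
  have h1 : Tendsto (fun n => Complex.I * ((⟪b n, θ⟫ : ℝ) : ℂ)) (hyperfilter ℕ)
      (𝓝 (Complex.I * ((⟪b₀, θ⟫ : ℝ) : ℂ))) :=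
    ((Complex.continuous_ofReal.tendsto _).comp (hb₀lim θ)).const_mul _
  rw [hψ, tendsto_nhds_unique h1 (hdrift θ), sub_add_cancel]

end LevyKhintchine


section LevyKhintchine

variable {E : Type*} [NormedAddCommGroup E] [InnerProductSpace ℝ E] [MeasurableSpace E]
  [BorelSpace E] [FiniteDimensional ℝ E]

/-- The polar coordinates of the points other than the origin. -/
def polarRegular (E : Type*) [NormedAddCommGroup E] [InnerProductSpace ℝ E] :
    Set (PolarSpace E) :=
  {y | y.toPoint ≠ 0}

theorem measurableSet_polarRegular : MeasurableSet (polarRegular E) :=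
  (isOpen_ne_fun continuous_toPoint continuous_const).measurableSet

theorem fst_ne_zero_of_mem_polarRegular {y : PolarSpace E} (hy : y ∈ polarRegular E) :
    y.1 ≠ 0 := fun h => hy (by rw [PolarSpace.toPoint, h, zero_smul])

/-- The Lévy measure attached to a measure in polar coordinates. -/
noncomputable def polarLevyMeasure (κ : Measure (PolarSpace E)) : Measure E :=
  ((κ.restrict (polarRegular E)).withDensity
    fun y => ENNReal.ofReal ((1 + y.1 ^ 2) / y.1 ^ 2)).map PolarSpace.toPoint

/-- The Gaussian covariance attached to a measure in polar coordinates: the second moment of the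
direction over the points lying above the origin. -/
noncomputable def polarGaussianCov (κ : Measure (PolarSpace E)) : E →L[ℝ] E :=
  ∫ y in (polarRegular E)ᶜ, InnerProductSpace.rankOne ℝ (y.2 : E) (y.2 : E) ∂κ

/-- The correction `(1 + r²)/r² x 𝟙_{‖x‖ ≤ 1} - x / r²`, with `x = r • s`, by which the drift has
to be changed to replace the truncation function `1 / (1 + r²)` by `𝟙_{‖x‖ ≤ 1}`. -/
noncomputable def polarTruncation (y : PolarSpace E) : E :=
  (Metric.closedBall (0 : E) 1).indicator (fun _ => (1 : ℝ)) y.toPoint •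
      ((1 + y.1 ^ 2) / y.1 ^ 2) • y.toPoint - (y.1 ^ 2)⁻¹ • y.toPoint

theorem norm_polarTruncation_le {y : PolarSpace E} (hy : y ∈ polarRegular E) :
    ‖polarTruncation y‖ ≤ 1 := by
  have hr := fst_ne_zero_of_mem_polarRegular hy
  have hs : ‖(y.2 : E)‖ ≤ 1 := mem_closedBall_zero_iff.1 y.2.2
  by_cases h : y.toPoint ∈ Metric.closedBall (0 : E) 1
  · have e : polarTruncation y = y.toPoint := by
      rw [polarTruncation, Set.indicator_of_mem h, one_smul, ← sub_smul]
      have : (1 + y.1 ^ 2) / y.1 ^ 2 - (y.1 ^ 2)⁻¹ = 1 := by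
        field_simp
        ring
      rw [this, one_smul]
    rw [e]
    exact mem_closedBall_zero_iff.1 h
  · rw [polarTruncation, Set.indicator_of_notMem h, zero_smul, zero_sub, norm_neg]
    rw [mem_closedBall_zero_iff, not_le] at h
    rw [PolarSpace.toPoint, norm_smul, Real.norm_eq_abs] at h
    have h1 : 1 ≤ |y.1| := by nlinarith [abs_nonneg y.1]
    rw [PolarSpace.toPoint, norm_smul, norm_smul, norm_inv, norm_pow, Real.norm_eq_abs,
      inv_mul_le_iff₀ (by positivity)]
    nlinarith [abs_nonneg y.1, norm_nonneg (y.2 : E)]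

theorem measurable_polarTruncation : Measurable (polarTruncation : PolarSpace E → E) := by
  have h := (continuous_toPoint (E := E)).measurable
  have h1 : Measurable fun y : PolarSpace E =>
      (Metric.closedBall (0 : E) 1).indicator (fun _ => (1 : ℝ)) y.toPoint :=
    (measurable_const.indicator measurableSet_closedBall).comp h
  unfold polarTruncation
  fun_prop

theorem polarLevyMeasure_zero (κ : Measure (PolarSpace E)) : polarLevyMeasure κ {0} = 0 := by
  rw [polarLevyMeasure, Measure.map_apply continuous_toPoint.measurable (measurableSet_singleton _)]
  refine withDensity_absolutelyContinuous _ _ ?_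
  rw [Measure.restrict_apply (continuous_toPoint.measurable (measurableSet_singleton _))]
  have : PolarSpace.toPoint ⁻¹' {(0 : E)} ∩ polarRegular E = ∅ := by
    ext y
    simp [polarRegular]
  rw [this, measure_empty]

theorem measurable_density :
    Measurable fun y : PolarSpace E => ENNReal.ofReal ((1 + y.1 ^ 2) / y.1 ^ 2) :=
  ENNReal.measurable_ofReal.comp (by fun_prop)

theorem integral_polarLevyMeasure {F : Type*} [NormedAddCommGroup F] [NormedSpace ℝ F]
    (κ : Measure (PolarSpace E)) {f : E → F} (hf : StronglyMeasurable f) :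
    ∫ x, f x ∂(polarLevyMeasure κ) =
      ∫ y in polarRegular E, ((1 + y.1 ^ 2) / y.1 ^ 2) • f y.toPoint ∂κ := by
  rw [polarLevyMeasure, integral_map continuous_toPoint.aemeasurable hf.aestronglyMeasurable,
    integral_withDensity_eq_integral_toReal_smul measurable_density
      (ae_of_all _ fun x => ENNReal.ofReal_lt_top)]
  refine integral_congr_ae (ae_of_all _ fun y => ?_)
  simp only
  rw [ENNReal.toReal_ofReal (by positivity)]

theorem integrable_polarLevyMeasure (κ : Measure (PolarSpace E)) [IsFiniteMeasure κ] :
    Integrable (fun x : E => min 1 (‖x‖ ^ 2)) (polarLevyMeasure κ) := by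
  rw [polarLevyMeasure, integrable_map_measure (Continuous.aestronglyMeasurable (by fun_prop))
    continuous_toPoint.aemeasurable,
    integrable_withDensity_iff_integrable_smul' measurable_density
      (ae_of_all _ fun x => ENNReal.ofReal_lt_top)]
  have hm := (continuous_toPoint (E := E)).measurable
  refine Integrable.of_bound (C := 2) (Measurable.aestronglyMeasurable ?_) ?_
  · refine measurable_density.ennreal_toReal.smul ?_
    exact Measurable.comp (g := fun x : E => min 1 (‖x‖ ^ 2)) (by fun_prop) hm
  · refine (ae_restrict_iff' measurableSet_polarRegular).2 (ae_of_all _ fun y hy => ?_)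
    have hr := fst_ne_zero_of_mem_polarRegular hy
    have hr2 : 0 < y.1 ^ 2 := by positivity
    have hs : ‖(y.2 : E)‖ ≤ 1 := mem_closedBall_zero_iff.1 y.2.2
    have h1 : ‖y.toPoint‖ ^ 2 ≤ y.1 ^ 2 := by
      rw [PolarSpace.toPoint, norm_smul, mul_pow, Real.norm_eq_abs, sq_abs]
      exact mul_le_of_le_one_right hr2.le (pow_le_one₀ (norm_nonneg _) hs)
    rw [ENNReal.toReal_ofReal (by positivity), smul_eq_mul, Function.comp_apply,
      Real.norm_of_nonneg (by positivity), div_mul_eq_mul_div, div_le_iff₀ hr2]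
    have h2 := min_le_left 1 (‖y.toPoint‖ ^ 2)
    have h3 := min_le_right 1 (‖y.toPoint‖ ^ 2)
    nlinarith

theorem integrable_rankOne (κ : Measure (PolarSpace E)) [IsFiniteMeasure κ] :
    Integrable (fun y : PolarSpace E => InnerProductSpace.rankOne ℝ (y.2 : E) (y.2 : E)) κ := by
  refine Integrable.of_bound (C := 1) (Continuous.aestronglyMeasurable ?_)
    (ae_of_all _ fun y => ?_)
  · exact (InnerProductSpace.rankOne ℝ (E := E) (F := E)).continuous₂.comp
      ((continuous_subtype_val.comp continuous_snd).prodMk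
        (continuous_subtype_val.comp continuous_snd))
  · have hs : ‖(y.2 : E)‖ ≤ 1 := mem_closedBall_zero_iff.1 y.2.2
    rw [InnerProductSpace.norm_rankOne]
    exact mul_le_one₀ hs (norm_nonneg _) hs

theorem inner_polarGaussianCov (κ : Measure (PolarSpace E)) [IsFiniteMeasure κ] (θ η : E) :
    ⟪η, polarGaussianCov κ θ⟫ = ∫ y in (polarRegular E)ᶜ, ⟪(y.2 : E), θ⟫ * ⟪η, y.2⟫ ∂κ := by
  have hint := (integrable_rankOne κ).restrict (s := (polarRegular E)ᶜ)
  rw [polarGaussianCov, ContinuousLinearMap.integral_apply hint, ← integral_inner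
    (hint.apply_continuousLinearMap θ)]
  simp [real_inner_smul_right]

theorem polarGaussianCov_isPositive (κ : Measure (PolarSpace E)) [IsFiniteMeasure κ] :
    (polarGaussianCov κ).IsPositive := by
  refine ⟨fun θ η => ?_, fun θ => ?_⟩
  · change ⟪polarGaussianCov κ θ, η⟫ = ⟪θ, polarGaussianCov κ η⟫
    rw [real_inner_comm, inner_polarGaussianCov, inner_polarGaussianCov]
    refine integral_congr_ae (ae_of_all _ fun y => ?_)
    simp only
    rw [real_inner_comm θ, real_inner_comm η, mul_comm]
  · rw [ContinuousLinearMap.reApplyInnerSelf_apply, real_inner_comm, RCLike.re_to_real,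
      inner_polarGaussianCov]
    refine integral_nonneg fun y => ?_
    simp only
    rw [real_inner_comm θ]
    exact mul_self_nonneg _

theorem polarKernel_of_notMem_polarRegular {y : PolarSpace E} (hy : y ∉ polarRegular E) (θ : E) :
    polarKernel θ y = ((-(⟪(y.2 : E), θ⟫ * ⟪θ, y.2⟫) / 2 : ℝ) : ℂ) := by
  have h0 : y.1 * ⟪θ, y.2⟫ = 0 := by
    rw [← real_inner_smul_right, show y.1 • (y.2 : E) = 0 from not_not.1 hy, inner_zero_right]
  rw [polarKernel, h0, expRemainder, if_pos rfl, real_inner_comm]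
  push_cast
  simp
  ring

/-- **Lévy–Khintchine theorem**: an infinitely divisible distribution on a finite-dimensional
inner product space has a characteristic triplet. -/
theorem exists_isTripletOf {μ : Measure E} [IsProbabilityMeasure μ]
    (h : IsInfinitelyDivisible μ) : ∃ T : Triplet E, T.IsTripletOf μ := by
  obtain ⟨κ, b, hκ, hμ⟩ := exists_polar_representation h
  have htrunc : IntegrableOn (polarTruncation (E := E)) (polarRegular E) κ :=
    Integrable.of_bound measurable_polarTruncation.aestronglyMeasurable 1
      ((ae_restrict_iff' measurableSet_polarRegular).2
        (ae_of_all _ fun y hy => norm_polarTruncation_le hy))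
  refine ⟨⟨b + ∫ y in polarRegular E, polarTruncation y ∂κ, polarGaussianCov κ,
    polarLevyMeasure κ⟩, polarGaussianCov_isPositive κ, polarLevyMeasure_zero κ,
    integrable_polarLevyMeasure κ, fun θ => ?_⟩
  rw [hμ, Triplet.exponent]
  congr 1
  have hk : Integrable (polarKernel θ) κ :=
    Integrable.of_bound (continuous_polarKernel θ).aestronglyMeasurable _
      (ae_of_all _ (norm_polarKernel_le θ))
  have hmeas : Measurable fun x : E => Complex.exp (Complex.I * (⟪θ, x⟫ : ℝ)) - 1
        - Complex.I * (⟪θ, x⟫ : ℝ) *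
          (Metric.closedBall (0 : E) 1).indicator (fun _ => (1 : ℂ)) x := by
    have h1 : Measurable fun x : E => ((⟪θ, x⟫ : ℝ) : ℂ) := Continuous.measurable (by fun_prop)
    exact ((Complex.measurable_exp.comp (h1.const_mul _)).sub_const _).sub
      ((h1.const_mul _).mul (measurable_const.indicator measurableSet_closedBall))
  have hgauss : ∫ y in (polarRegular E)ᶜ, polarKernel θ y ∂κ =
      -((⟪θ, polarGaussianCov κ θ⟫ / 2 : ℝ) : ℂ) := by
    rw [setIntegral_congr_fun measurableSet_polarRegular.compl
      fun y hy => polarKernel_of_notMem_polarRegular hy θ, integral_complex_ofReal,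
      inner_polarGaussianCov, integral_div, integral_neg]
    push_cast
    ring
  have hinner_int : IntegrableOn (fun y => ((⟪θ, polarTruncation y⟫ : ℝ) : ℂ))
      (polarRegular E) κ := (htrunc.const_inner θ).ofReal
  have hlevy : ∫ x, (Complex.exp (Complex.I * (⟪θ, x⟫ : ℝ)) - 1
        - Complex.I * (⟪θ, x⟫ : ℝ) *
          (Metric.closedBall (0 : E) 1).indicator (fun _ => (1 : ℂ)) x) ∂(polarLevyMeasure κ) =
      ∫ y in polarRegular E, polarKernel θ y ∂κ -
        Complex.I * ((⟪θ, ∫ y in polarRegular E, polarTruncation y ∂κ⟫ : ℝ) : ℂ) := by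
    rw [integral_polarLevyMeasure κ hmeas.stronglyMeasurable, ← integral_inner htrunc θ,
      ← integral_complex_ofReal, ← integral_const_mul,
      ← integral_sub hk.integrableOn (hinner_int.const_mul _)]
    refine setIntegral_congr_fun measurableSet_polarRegular fun y hy => ?_
    have hr : (y.1 : ℂ) ≠ 0 := by exact_mod_cast fst_ne_zero_of_mem_polarRegular hy
    refine mul_left_cancel₀ (pow_ne_zero 2 hr) ?_
    rw [mul_sub _ (polarKernel θ y), sq_mul_polarKernel, polarTruncation, inner_sub_right,
      real_inner_smul_right, real_inner_smul_right, real_inner_smul_right, Complex.real_smul]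
    by_cases hb : y.toPoint ∈ Metric.closedBall (0 : E) 1
    · rw [Set.indicator_of_mem hb, Set.indicator_of_mem hb]
      push_cast
      field_simp
      ring
    · rw [Set.indicator_of_notMem hb, Set.indicator_of_notMem hb]
      push_cast
      field_simp
      ring
  rw [hlevy, ← integral_add_compl measurableSet_polarRegular hk, hgauss, inner_add_left,
    real_inner_comm θ (∫ y in polarRegular E, polarTruncation y ∂κ)]
  push_cast
  ring

theorem triplet_isTripletOf {μ : Measure E} [IsProbabilityMeasure μ]
    (h : IsInfinitelyDivisible μ) : (triplet μ).IsTripletOf μ := by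
  have hex := exists_isTripletOf h
  rw [triplet, dif_pos hex]
  exact hex.choose_spec

end LevyKhintchine


/-! ### Laws of the field -/

theorem IsInfinitelyDivisible.map {F G : Type*} [AddCommMonoid F] [MeasurableSpace F]
    [MeasurableAdd₂ F] [AddCommMonoid G] [MeasurableSpace G] [MeasurableAdd₂ G] {μ : Measure F}
    (h : IsInfinitelyDivisible μ) (L : F →+ G) (hL : Measurable L) :
    IsInfinitelyDivisible (μ.map L) := by
  intro n hn
  obtain ⟨ρ, hρ, rfl⟩ := h n hn
  have := Measure.isProbabilityMeasure_map (μ := ρ) hL.aemeasurable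
  refine ⟨ρ.map L, this, ?_⟩
  rw [← Measure.pi_map_pi fun _ => hL.aemeasurable, Measure.map_map (by fun_prop) (by fun_prop),
    Measure.map_map hL (by fun_prop)]
  congr 1
  ext x
  simp

section Laws

variable {Ω : Type*} [MeasurableSpace Ω] {l d : ℕ} {P : Measure Ω} [IsProbabilityMeasure P]
  {X : (Fin l → ℝ) → Ω → EuclideanSpace ℝ (Fin d)}

/-- The characteristic function of `X_s`. -/
noncomputable def onePointChar (P : Measure Ω) (X : (Fin l → ℝ) → Ω → EuclideanSpace ℝ (Fin d))
    (s : Fin l → ℝ) (a : EuclideanSpace ℝ (Fin d)) : ℂ :=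
  ∫ ω, Complex.exp (Complex.I * ((⟪a, X s ω⟫ : ℝ) : ℂ)) ∂P

/-- The characteristic function of `(X_s, X_t)`. -/
noncomputable def twoPointChar (P : Measure Ω) (X : (Fin l → ℝ) → Ω → EuclideanSpace ℝ (Fin d))
    (s t : Fin l → ℝ) (a b : EuclideanSpace ℝ (Fin d)) : ℂ :=
  ∫ ω, Complex.exp (Complex.I * ((⟪a, X s ω⟫ + ⟪b, X t ω⟫ : ℝ) : ℂ)) ∂P

theorem twoPointChar_zero_right (s t : Fin l → ℝ) (a : EuclideanSpace ℝ (Fin d)) :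
    twoPointChar P X s t a 0 = onePointChar P X s a := by
  simp [twoPointChar, onePointChar]

theorem twoPointChar_zero_left (s t : Fin l → ℝ) (b : EuclideanSpace ℝ (Fin d)) :
    twoPointChar P X s t 0 b = onePointChar P X t b := by
  simp [twoPointChar, onePointChar]

theorem IsStrictlyStationary.integral_shift (hstat : IsStrictlyStationary P X)
    (hX : ∀ t, Measurable (X t)) {m : ℕ} (s : Fin m → Fin l → ℝ) (h : Fin l → ℝ)
    {f : (Fin m → EuclideanSpace ℝ (Fin d)) → ℂ} (hf : Continuous f) :
    ∫ ω, f (fun i => X (s i + h) ω) ∂P = ∫ ω, f (fun i => X (s i) ω) ∂P := by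
  have h1 := integral_map (μ := P) (φ := fun ω (i : Fin m) => X (s i + h) ω)
    (measurable_pi_lambda _ fun i => hX _).aemeasurable hf.aestronglyMeasurable
  have h2 := integral_map (μ := P) (φ := fun ω (i : Fin m) => X (s i) ω)
    (measurable_pi_lambda _ fun i => hX _).aemeasurable hf.aestronglyMeasurable
  rw [← h1, ← h2, hstat]

theorem twoPointChar_add (hstat : IsStrictlyStationary P X) (hX : ∀ t, Measurable (X t))
    (s t h : Fin l → ℝ) (a b : EuclideanSpace ℝ (Fin d)) :
    twoPointChar P X (s + h) (t + h) a b = twoPointChar P X s t a b := by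
  have := hstat.integral_shift hX ![s, t] h (f := fun x =>
    Complex.exp (Complex.I * ((⟪a, x 0⟫ + ⟪b, x 1⟫ : ℝ) : ℂ))) (by fun_prop)
  simpa [twoPointChar] using this

theorem onePointChar_eq (hstat : IsStrictlyStationary P X) (hX : ∀ t, Measurable (X t))
    (s : Fin l → ℝ) (a : EuclideanSpace ℝ (Fin d)) :
    onePointChar P X s a = onePointChar P X 0 a := by
  have := twoPointChar_add hstat hX 0 0 s a 0
  rwa [twoPointChar_zero_right, twoPointChar_zero_right, zero_add] at this

theorem twoPointChar_eq (hstat : IsStrictlyStationary P X) (hX : ∀ t, Measurable (X t))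
    (s t : Fin l → ℝ) (a b : EuclideanSpace ℝ (Fin d)) :
    twoPointChar P X s t a b = twoPointChar P X 0 (t - s) a b := by
  have := twoPointChar_add hstat hX 0 (t - s) s a b
  rwa [zero_add, sub_add_cancel] at this

theorem isProbabilityMeasure_pairLaw (hX : ∀ t, Measurable (X t)) (t : Fin l → ℝ) :
    IsProbabilityMeasure (pairLaw P X t) :=
  Measure.isProbabilityMeasure_map (Measurable.aemeasurable (by fun_prop))

theorem isInfinitelyDivisible_pairLaw (hX : ∀ t, Measurable (X t))
    (hID : IsInfinitelyDivisibleField P X) (t : Fin l → ℝ) :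
    IsInfinitelyDivisible (pairLaw P X t) := by
  let L : (Fin 2 → EuclideanSpace ℝ (Fin d)) →+
      WithLp 2 (EuclideanSpace ℝ (Fin d) × EuclideanSpace ℝ (Fin d)) :=
    { toFun := fun x => WithLp.toLp 2 (x 0, x 1)
      map_zero' := rfl
      map_add' := fun _ _ => rfl }
  have hL : Measurable L := by
    change Measurable fun x : Fin 2 → EuclideanSpace ℝ (Fin d) => WithLp.toLp 2 (x 0, x 1)
    fun_prop
  have h := (hID 2 ![0, t]).map L hL
  rwa [Measure.map_map hL (measurable_pi_lambda _ fun i => hX _)] at h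

theorem isTripletOf_pairLaw (hX : ∀ t, Measurable (X t)) (hID : IsInfinitelyDivisibleField P X)
    (t : Fin l → ℝ) : (triplet (pairLaw P X t)).IsTripletOf (pairLaw P X t) :=
  have := isProbabilityMeasure_pairLaw (P := P) hX t
  triplet_isTripletOf (isInfinitelyDivisible_pairLaw hX hID t)

theorem charFun_pairLaw (hX : ∀ t, Measurable (X t)) (t : Fin l → ℝ)
    (a b : EuclideanSpace ℝ (Fin d)) :
    charFun (pairLaw P X t) (WithLp.toLp 2 (a, b)) = twoPointChar P X 0 t a b := by
  rw [charFun_apply, pairLaw, integral_map (Measurable.aemeasurable (by fun_prop))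
    (Continuous.aestronglyMeasurable (by fun_prop)), twoPointChar]
  refine integral_congr_ae (ae_of_all _ fun ω => ?_)
  simp only
  rw [WithLp.prod_inner_apply, mul_comm, real_inner_comm a, real_inner_comm b]

/-- The vector `(a, 0)` of `ℝᵈ × ℝᵈ`. -/
def leftVec (a : EuclideanSpace ℝ (Fin d)) :
    WithLp 2 (EuclideanSpace ℝ (Fin d) × EuclideanSpace ℝ (Fin d)) := WithLp.toLp 2 (a, 0)

/-- The vector `(0, b)` of `ℝᵈ × ℝᵈ`. -/
def rightVec (b : EuclideanSpace ℝ (Fin d)) :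
    WithLp 2 (EuclideanSpace ℝ (Fin d) × EuclideanSpace ℝ (Fin d)) := WithLp.toLp 2 (0, b)

theorem smul_leftVec (c : ℝ) (a : EuclideanSpace ℝ (Fin d)) :
    c • leftVec a = leftVec (c • a) := by
  rw [leftVec, leftVec, ← WithLp.toLp_smul, Prod.smul_mk, smul_zero]

theorem smul_rightVec (c : ℝ) (b : EuclideanSpace ℝ (Fin d)) :
    c • rightVec b = rightVec (c • b) := by
  rw [rightVec, rightVec, ← WithLp.toLp_smul, Prod.smul_mk, smul_zero]

theorem leftVec_add_rightVec (a b : EuclideanSpace ℝ (Fin d)) :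
    leftVec a + rightVec b = WithLp.toLp 2 (a, b) := by
  rw [leftVec, rightVec, ← WithLp.toLp_add, Prod.mk_add_mk, add_zero, zero_add]

theorem inner_leftVec (a : EuclideanSpace ℝ (Fin d))
    (z : WithLp 2 (EuclideanSpace ℝ (Fin d) × EuclideanSpace ℝ (Fin d))) :
    ⟪leftVec a, z⟫ = ⟪a, z.fst⟫ := by
  simp [leftVec, WithLp.prod_inner_apply]

theorem inner_rightVec (b : EuclideanSpace ℝ (Fin d))
    (z : WithLp 2 (EuclideanSpace ℝ (Fin d) × EuclideanSpace ℝ (Fin d))) :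
    ⟪rightVec b, z⟫ = ⟪b, z.snd⟫ := by
  simp [rightVec, WithLp.prod_inner_apply]

theorem leftVec_eq_sum (a : EuclideanSpace ℝ (Fin d)) :
    leftVec a = ∑ j, a j • leftVec (EuclideanSpace.single j (1 : ℝ)) := by
  refine ext_inner_right ℝ fun z => ?_
  simp_rw [sum_inner, real_inner_smul_left, inner_leftVec]
  simp [PiLp.inner_apply, mul_comm]

theorem rightVec_eq_sum (b : EuclideanSpace ℝ (Fin d)) :
    rightVec b = ∑ j, b j • rightVec (EuclideanSpace.single j (1 : ℝ)) := by
  refine ext_inner_right ℝ fun z => ?_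
  simp_rw [sum_inner, real_inner_smul_left, inner_rightVec]
  simp [PiLp.inner_apply, mul_comm]

theorem charFun_pairLaw_leftVec (hX : ∀ t, Measurable (X t)) (t : Fin l → ℝ)
    (a : EuclideanSpace ℝ (Fin d)) :
    charFun (pairLaw P X t) (leftVec a) = onePointChar P X 0 a := by
  rw [leftVec, charFun_pairLaw hX, twoPointChar_zero_right]

theorem charFun_pairLaw_rightVec (hstat : IsStrictlyStationary P X) (hX : ∀ t, Measurable (X t))
    (t : Fin l → ℝ) (b : EuclideanSpace ℝ (Fin d)) :
    charFun (pairLaw P X t) (rightVec b) = onePointChar P X 0 b := by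
  rw [rightVec, charFun_pairLaw hX, twoPointChar_zero_left, onePointChar_eq hstat hX]

theorem constMarginal_leftVec (hX : ∀ t, Measurable (X t)) (t : ℕ → Fin l → ℝ)
    (a : EuclideanSpace ℝ (Fin d)) : ConstMarginal (fun n => pairLaw P X (t n)) (leftVec a) :=
  fun n c => by
    rw [smul_leftVec, charFun_pairLaw_leftVec hX, charFun_pairLaw_leftVec hX]

theorem constMarginal_rightVec (hstat : IsStrictlyStationary P X) (hX : ∀ t, Measurable (X t))
    (t : ℕ → Fin l → ℝ) (b : EuclideanSpace ℝ (Fin d)) :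
    ConstMarginal (fun n => pairLaw P X (t n)) (rightVec b) :=
  fun n c => by
    rw [smul_rightVec, charFun_pairLaw_rightVec hstat hX, charFun_pairLaw_rightVec hstat hX]

theorem EscapesToInfinity.add_const {t : ℕ → Fin l → ℝ} (ht : EscapesToInfinity t)
    (h : Fin l → ℝ) : EscapesToInfinity fun n => t n + h := by
  refine tendsto_atTop_mono (fun n => ?_)
    (tendsto_atTop_add_const_right atTop (-‖h‖) (show Tendsto (fun n => ‖t n‖) atTop atTop from ht))
  have := norm_sub_le (t n + h) h
  rw [add_sub_cancel_right] at this
  linarith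

/-! ### Mixing and the characteristics of pairs -/

/-- A mixing field has asymptotically independent pairs: the case `m = 1` of the definition. -/
theorem IsMixing.tendsto_twoPointChar (h : IsMixing P X) {t : ℕ → Fin l → ℝ}
    (ht : EscapesToInfinity t) (a b : EuclideanSpace ℝ (Fin d)) :
    Tendsto (fun n => twoPointChar P X 0 (t n) a b) atTop
      (𝓝 (onePointChar P X 0 a * onePointChar P X 0 b)) := by
  have := h 1 (fun _ => 0) (fun _ => 0) (fun _ => a) (fun _ => b) t ht
  simpa [twoPointChar, onePointChar, mul_add] using this

theorem asymptoticallyIndependent_of_tendsto (hstat : IsStrictlyStationary P X)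
    (hX : ∀ t, Measurable (X t)) {t : ℕ → Fin l → ℝ}
    (h : ∀ a b, Tendsto (fun n => twoPointChar P X 0 (t n) a b) atTop
      (𝓝 (onePointChar P X 0 a * onePointChar P X 0 b))) (a b : EuclideanSpace ℝ (Fin d)) :
    AsymptoticallyIndependent (fun n => pairLaw P X (t n)) (leftVec a) (rightVec b) := by
  intro c c'
  simp_rw [smul_leftVec, smul_rightVec, charFun_pairLaw_leftVec hX,
    charFun_pairLaw_rightVec hstat hX, leftVec_add_rightVec, charFun_pairLaw hX]
  exact h _ _

theorem norm_mul_norm_le_sum (x y : EuclideanSpace ℝ (Fin d)) :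
    ‖x‖ * ‖y‖ ≤ ∑ j, ∑ k, |x j| * |y k| := by
  have h (x : EuclideanSpace ℝ (Fin d)) : ‖x‖ ≤ ∑ j, |x j| := by
    rw [EuclideanSpace.norm_eq, Real.sqrt_le_left (Finset.sum_nonneg fun j _ => abs_nonneg _)]
    simpa using Finset.sum_sq_le_sq_sum_of_nonneg (s := Finset.univ) (f := fun j => |x j|)
      fun j _ => abs_nonneg _
  rw [← Finset.sum_mul_sum]
  exact mul_le_mul (h x) (h y) (norm_nonneg _) (Finset.sum_nonneg fun j _ => abs_nonneg _)

theorem tendsto_pairLevyMeasure_of_coordinates {t : ℕ → Fin l → ℝ}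
    (h : ∀ (j k : Fin d) (δ : ℝ), 0 < δ → Tendsto (fun n => pairLevyMeasure P X (t n)
      {z | δ < |⟪leftVec (EuclideanSpace.single j (1 : ℝ)), z⟫| *
        |⟪rightVec (EuclideanSpace.single k (1 : ℝ)), z⟫|}) atTop (𝓝 0)) {δ : ℝ} (hδ : 0 < δ) :
    Tendsto (fun n => pairLevyMeasure P X (t n) {z | δ < ‖z.fst‖ * ‖z.snd‖}) atTop (𝓝 0) := by
  set ε := δ / ((d : ℝ) * d + 1) with hε
  have hε0 : 0 < ε := by positivity
  have hsub : {z : WithLp 2 (EuclideanSpace ℝ (Fin d) × EuclideanSpace ℝ (Fin d)) |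
      δ < ‖z.fst‖ * ‖z.snd‖} ⊆ ⋃ j : Fin d, ⋃ k : Fin d,
        {z | ε < |⟪leftVec (EuclideanSpace.single j (1 : ℝ)), z⟫| *
          |⟪rightVec (EuclideanSpace.single k (1 : ℝ)), z⟫|} := by
    intro z hz
    by_contra hcon
    simp only [Set.mem_iUnion, Set.mem_ofPred_eq, not_exists, not_lt, inner_leftVec,
      inner_rightVec, EuclideanSpace.inner_single_left, map_one, one_mul] at hcon
    have h1 : ‖z.fst‖ * ‖z.snd‖ ≤ ∑ _j : Fin d, ∑ _k : Fin d, ε :=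
      (norm_mul_norm_le_sum _ _).trans
        (Finset.sum_le_sum fun j _ => Finset.sum_le_sum fun k _ => hcon j k)
    simp only [Finset.sum_const, Finset.card_univ, Fintype.card_fin, nsmul_eq_mul] at h1
    have h2 : ((d : ℝ) * d + 1) * ε = δ := by
      rw [hε]
      field_simp
    have h3 : δ < ‖z.fst‖ * ‖z.snd‖ := hz
    nlinarith
  refine tendsto_of_tendsto_of_tendsto_of_le_of_le tendsto_const_nhds
    (h := fun n => ∑ j : Fin d, ∑ k : Fin d, pairLevyMeasure P X (t n)
      {z | ε < |⟪leftVec (EuclideanSpace.single j (1 : ℝ)), z⟫| *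
        |⟪rightVec (EuclideanSpace.single k (1 : ℝ)), z⟫|}) ?_ (fun _ => zero_le) fun n => ?_
  · simpa using tendsto_finsetSum Finset.univ fun j _ => tendsto_finsetSum Finset.univ fun k _ =>
      h j k ε hε0
  · refine (measure_mono hsub).trans ((measure_iUnion_fintype_le _ _).trans
      (Finset.sum_le_sum fun j _ => measure_iUnion_fintype_le _ _))

theorem tendsto_pairLevyMeasure_directions {t : ℕ → Fin l → ℝ}
    (h : ∀ δ : ℝ, 0 < δ → Tendsto (fun n => pairLevyMeasure P X (t n)
      {z | δ < ‖z.fst‖ * ‖z.snd‖}) atTop (𝓝 0)) (a b : EuclideanSpace ℝ (Fin d)) {δ : ℝ}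
    (hδ : 0 < δ) :
    Tendsto (fun n => pairLevyMeasure P X (t n) {z | δ < |⟪leftVec a, z⟫| * |⟪rightVec b, z⟫|})
      atTop (𝓝 0) := by
  refine tendsto_of_tendsto_of_tendsto_of_le_of_le tendsto_const_nhds
    (h (δ / (‖a‖ * ‖b‖ + 1)) (by positivity)) (fun _ => zero_le) fun n => measure_mono ?_
  intro z hz
  simp only [Set.mem_ofPred_eq, inner_leftVec, inner_rightVec] at hz ⊢
  rw [div_lt_iff₀ (by positivity)]
  have h1 := mul_le_mul (abs_real_inner_le_norm a z.fst) (abs_real_inner_le_norm b z.snd)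
    (abs_nonneg _) (by positivity)
  have h2 : 0 ≤ ‖z.fst‖ * ‖z.snd‖ := by positivity
  nlinarith

theorem tendsto_inner_of_gaussianCrossCov {t : ℕ → Fin l → ℝ}
    (h : Tendsto (fun n => gaussianCrossCov P X (t n)) atTop (𝓝 0))
    (a b : EuclideanSpace ℝ (Fin d)) :
    Tendsto (fun n => ⟪leftVec a, (triplet (pairLaw P X (t n))).gaussianCov (rightVec b)⟫)
      atTop (𝓝 0) := by
  have hentry (j k : Fin d) : Tendsto (fun n => gaussianCrossCov P X (t n) j k) atTop (𝓝 0) :=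
    tendsto_pi_nhds.1 (tendsto_pi_nhds.1 h j) k
  have hsum (n : ℕ) : ⟪leftVec a, (triplet (pairLaw P X (t n))).gaussianCov (rightVec b)⟫ =
      ∑ j, ∑ k, a j * (b k * gaussianCrossCov P X (t n) j k) := by
    rw [leftVec_eq_sum a, rightVec_eq_sum b, map_sum, sum_inner]
    simp_rw [inner_sum, map_smul, real_inner_smul_left, real_inner_smul_right]
    rfl
  simp_rw [hsum]
  simpa using tendsto_finsetSum Finset.univ fun j _ => tendsto_finsetSum Finset.univ fun k _ =>
    ((hentry j k).const_mul (b k)).const_mul (a j)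

/-- The conditions on the characteristics imply asymptotic independence of pairs. -/
theorem tendsto_twoPointChar_of_conditions (hstat : IsStrictlyStationary P X)
    (hX : ∀ t, Measurable (X t)) (hID : IsInfinitelyDivisibleField P X) {t : ℕ → Fin l → ℝ}
    (hcov : Tendsto (fun n => gaussianCrossCov P X (t n)) atTop (𝓝 0))
    (hQ : ∀ δ : ℝ, 0 < δ → Tendsto (fun n => pairLevyMeasure P X (t n)
      {z | δ < ‖z.fst‖ * ‖z.snd‖}) atTop (𝓝 0)) (a b : EuclideanSpace ℝ (Fin d)) :
    Tendsto (fun n => twoPointChar P X 0 (t n) a b) atTop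
      (𝓝 (onePointChar P X 0 a * onePointChar P X 0 b)) := by
  have hT n := isTripletOf_pairLaw (P := P) hX hID (t n)
  have hK := tendsto_crossMoment_of_measure hT (constMarginal_leftVec hX t a)
    (constMarginal_rightVec hstat hX t b) fun δ hδ => tendsto_pairLevyMeasure_directions hQ a b hδ
  have := tendsto_charFun_add hT (fun n => charFun_pairLaw_leftVec hX (t n) a)
    (fun n => charFun_pairLaw_rightVec hstat hX (t n) b)
    (tendsto_inner_of_gaussianCrossCov hcov a b) hK
  simpa only [leftVec_add_rightVec, charFun_pairLaw hX] using this

/-! ### From pairs to finite families of times -/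

/-- The joint law of the scalar variables `⟪θ₁ j, X_{s j}⟫` and `⟪θ₂ k, X_{q k}⟫`. -/
noncomputable def scalarLaw (P : Measure Ω) (X : (Fin l → ℝ) → Ω → EuclideanSpace ℝ (Fin d))
    {m : ℕ} (s q : Fin m → Fin l → ℝ) (θ₁ θ₂ : Fin m → EuclideanSpace ℝ (Fin d)) :
    Measure (EuclideanSpace ℝ (Fin m ⊕ Fin m)) :=
  P.map fun ω => WithLp.toLp 2
    (Sum.elim (fun j => ⟪θ₁ j, X (s j) ω⟫) (fun k => ⟪θ₂ k, X (q k) ω⟫))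

variable {m : ℕ} (s q : Fin m → Fin l → ℝ) (θ₁ θ₂ : Fin m → EuclideanSpace ℝ (Fin d))

theorem measurable_scalarLaw (hX : ∀ t, Measurable (X t)) :
    Measurable fun ω => (WithLp.toLp 2
      (Sum.elim (fun j => ⟪θ₁ j, X (s j) ω⟫) (fun k => ⟪θ₂ k, X (q k) ω⟫)) :
        EuclideanSpace ℝ (Fin m ⊕ Fin m)) := by
  refine (WithLp.measurable_toLp 2 _).comp (measurable_pi_lambda _ ?_)
  rintro (j | k)
  · simp only [Sum.elim_inl]
    fun_prop
  · simp only [Sum.elim_inr]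
    fun_prop

theorem isProbabilityMeasure_scalarLaw (hX : ∀ t, Measurable (X t)) :
    IsProbabilityMeasure (scalarLaw P X s q θ₁ θ₂) :=
  Measure.isProbabilityMeasure_map (measurable_scalarLaw s q θ₁ θ₂ hX).aemeasurable

theorem isInfinitelyDivisible_scalarLaw (hX : ∀ t, Measurable (X t))
    (hID : IsInfinitelyDivisibleField P X) :
    IsInfinitelyDivisible (scalarLaw P X s q θ₁ θ₂) := by
  let L : (Fin (m + m) → EuclideanSpace ℝ (Fin d)) →+ EuclideanSpace ℝ (Fin m ⊕ Fin m) :=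
    { toFun := fun x => WithLp.toLp 2 (Sum.elim (fun j => ⟪θ₁ j, x (Fin.castAdd m j)⟫)
        (fun k => ⟪θ₂ k, x (Fin.natAdd m k)⟫))
      map_zero' := by
        ext (j | k) <;> simp
      map_add' := fun x y => by
        ext (j | k) <;> simp [inner_add_right] }
  have hL : Measurable L := by
    refine (WithLp.measurable_toLp 2 _).comp (measurable_pi_lambda _ ?_)
    rintro (j | k)
    · simp only [Sum.elim_inl]
      fun_prop
    · simp only [Sum.elim_inr]
      fun_prop
  have h := (hID (m + m) (Fin.append s q)).map L hL
  rw [Measure.map_map hL (measurable_pi_lambda _ fun i => hX _)] at h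
  have e : (L ∘ fun ω i => X (Fin.append s q i) ω) = fun ω => WithLp.toLp 2
      (Sum.elim (fun j => ⟪θ₁ j, X (s j) ω⟫) (fun k => ⟪θ₂ k, X (q k) ω⟫)) := by
    funext ω
    ext (j | k)
    · change ⟪θ₁ j, X (Fin.append s q (Fin.castAdd m j)) ω⟫ = ⟪θ₁ j, X (s j) ω⟫
      rw [Fin.append_left]
    · change ⟪θ₂ k, X (Fin.append s q (Fin.natAdd m k)) ω⟫ = ⟪θ₂ k, X (q k) ω⟫
      rw [Fin.append_right]
  rwa [e] at h

theorem charFun_scalarLaw (hX : ∀ t, Measurable (X t))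
    (w : EuclideanSpace ℝ (Fin m ⊕ Fin m)) :
    charFun (scalarLaw P X s q θ₁ θ₂) w =
      ∫ ω, Complex.exp (Complex.I * ((∑ j, w (Sum.inl j) * ⟪θ₁ j, X (s j) ω⟫ : ℝ) : ℂ) +
        Complex.I * ((∑ k, w (Sum.inr k) * ⟪θ₂ k, X (q k) ω⟫ : ℝ) : ℂ)) ∂P := by
  rw [charFun_apply, scalarLaw, integral_map (measurable_scalarLaw s q θ₁ θ₂ hX).aemeasurable
    (Continuous.aestronglyMeasurable (by fun_prop))]
  refine integral_congr_ae (ae_of_all _ fun ω => ?_)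
  simp only
  rw [PiLp.inner_apply, Fintype.sum_sum_type]
  simp only [Sum.elim_inl, Sum.elim_inr, RCLike.inner_apply, conj_trivial]
  push_cast
  rw [mul_comm, mul_add]

theorem charFun_scalarLaw_single_add_single (hX : ∀ t, Measurable (X t)) (c c' : ℝ)
    (j k : Fin m) :
    charFun (scalarLaw P X s q θ₁ θ₂) (c • EuclideanSpace.single (Sum.inl j) (1 : ℝ) +
      c' • EuclideanSpace.single (Sum.inr k) (1 : ℝ)) =
        twoPointChar P X (s j) (q k) (c • θ₁ j) (c' • θ₂ k) := by
  rw [charFun_scalarLaw s q θ₁ θ₂ hX, twoPointChar]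
  refine integral_congr_ae (ae_of_all _ fun ω => ?_)
  simp [real_inner_smul_left, mul_add]

theorem charFun_scalarLaw_inl (hstat : IsStrictlyStationary P X) (hX : ∀ t, Measurable (X t))
    (c : ℝ) (j : Fin m) :
    charFun (scalarLaw P X s q θ₁ θ₂) (c • EuclideanSpace.single (Sum.inl j) (1 : ℝ)) =
        onePointChar P X 0 (c • θ₁ j) := by
  have := charFun_scalarLaw_single_add_single (P := P) s q θ₁ θ₂ hX c 0 j j
  rwa [zero_smul, add_zero, zero_smul, twoPointChar_zero_right, onePointChar_eq hstat hX] at this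

theorem charFun_scalarLaw_inr (hstat : IsStrictlyStationary P X) (hX : ∀ t, Measurable (X t))
    (c : ℝ) (k : Fin m) :
    charFun (scalarLaw P X s q θ₁ θ₂) (c • EuclideanSpace.single (Sum.inr k) (1 : ℝ)) =
        onePointChar P X 0 (c • θ₂ k) := by
  have := charFun_scalarLaw_single_add_single (P := P) s q θ₁ θ₂ hX 0 c k k
  rwa [zero_smul, zero_add, zero_smul, twoPointChar_zero_left, onePointChar_eq hstat hX] at this

/-- Asymptotic independence of pairs implies mixing. -/
theorem isMixing_of_tendsto_twoPointChar (hstat : IsStrictlyStationary P X)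
    (hX : ∀ t, Measurable (X t)) (hID : IsInfinitelyDivisibleField P X)
    (h : ∀ t : ℕ → Fin l → ℝ, EscapesToInfinity t → ∀ a b,
      Tendsto (fun n => twoPointChar P X 0 (t n) a b) atTop
        (𝓝 (onePointChar P X 0 a * onePointChar P X 0 b))) : IsMixing P X := by
  intro m s p θ₁ θ₂ t ht
  set μ : ℕ → Measure (EuclideanSpace ℝ (Fin m ⊕ Fin m)) :=
    fun n => scalarLaw P X s (fun k => p k + t n) θ₁ θ₂ with hμ
  have hT (n : ℕ) : (triplet (μ n)).IsTripletOf (μ n) :=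
    have := isProbabilityMeasure_scalarLaw (P := P) s (fun k => p k + t n) θ₁ θ₂ hX
    triplet_isTripletOf (isInfinitelyDivisible_scalarLaw s _ θ₁ θ₂ hX hID)
  have hind (j k : Fin m) : AsymptoticallyIndependent μ
      (EuclideanSpace.single (Sum.inl j) (1 : ℝ)) (EuclideanSpace.single (Sum.inr k) (1 : ℝ)) := by
    intro c c'
    simp only [hμ, charFun_scalarLaw_inl s _ θ₁ θ₂ hstat hX,
      charFun_scalarLaw_inr s _ θ₁ θ₂ hstat hX,
      charFun_scalarLaw_single_add_single s _ θ₁ θ₂ hX, twoPointChar_eq hstat hX (s _)]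
    have := h _ (ht.add_const (p k - s j)) (c • θ₁ j) (c' • θ₂ k)
    refine this.congr fun n => ?_
    congr 1
    abel
  have key := tendsto_charFun_sum_add_sum (μ := μ) hT
    (u := fun j : Fin m => EuclideanSpace.single (Sum.inl j) (1 : ℝ))
    (v := fun k : Fin m => EuclideanSpace.single (Sum.inr k) (1 : ℝ))
    (a := ∫ ω, Complex.exp (Complex.I * ((∑ j, ⟪θ₁ j, X (s j) ω⟫ : ℝ) : ℂ)) ∂P)
    (b := ∫ ω, Complex.exp (Complex.I * ((∑ j, ⟪θ₂ j, X (p j) ω⟫ : ℝ) : ℂ)) ∂P)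
    (fun j n c => by
      simp only [hμ, charFun_scalarLaw_inl s _ θ₁ θ₂ hstat hX])
    (fun k n c => by
      simp only [hμ, charFun_scalarLaw_inr s _ θ₁ θ₂ hstat hX])
    hind
    (fun n => by
      simp only [hμ]
      rw [charFun_scalarLaw s _ θ₁ θ₂ hX]
      simp [Pi.single_apply])
    (fun n => by
      simp only [hμ]
      rw [charFun_scalarLaw s _ θ₁ θ₂ hX, ← hstat.integral_shift hX p (t n) (f := fun x =>
        Complex.exp (Complex.I * ((∑ j, ⟪θ₂ j, x j⟫ : ℝ) : ℂ))) (by fun_prop)]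
      simp [Pi.single_apply])
  refine key.congr fun n => ?_
  simp only [hμ]
  rw [charFun_scalarLaw s _ θ₁ θ₂ hX]
  simp [Pi.single_apply]

end Laws

end IDField

theorem mainTheorem2 {Ω : Type*} [MeasurableSpace Ω] (P : Measure Ω) [IsProbabilityMeasure P]
    (l d : ℕ) (X : (Fin l → ℝ) → Ω → EuclideanSpace ℝ (Fin d))
    (hX : ∀ t, Measurable (X t))
    (hstat : IDField.IsStrictlyStationary P X)
    (hID : IDField.IsInfinitelyDivisibleField P X) :
    IDField.IsMixing P X ↔
      ∀ t : ℕ → Fin l → ℝ, IDField.EscapesToInfinity t →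
        Tendsto (fun n => IDField.gaussianCrossCov P X (t n)) atTop (𝓝 0) ∧
        ∀ δ : ℝ, 0 < δ →
          Tendsto (fun n => IDField.pairLevyMeasure P X (t n)
            {z | δ < ‖z.fst‖ * ‖z.snd‖}) atTop (𝓝 0) := by
  constructor
  · intro hmix t ht
    have hT n := IDField.isTripletOf_pairLaw (P := P) hX hID (t n)
    have hind := IDField.asymptoticallyIndependent_of_tendsto hstat hX
      (hmix.tendsto_twoPointChar ht)
    refine ⟨tendsto_pi_nhds.2 fun j => tendsto_pi_nhds.2 fun k => ?_, fun δ hδ => ?_⟩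
    · exact (hind (EuclideanSpace.single j 1) (EuclideanSpace.single k 1)).tendsto_gaussianCov hT
        (IDField.constMarginal_leftVec hX t _) (IDField.constMarginal_rightVec hstat hX t _)
    · refine IDField.tendsto_pairLevyMeasure_of_coordinates (fun j k ε hε => ?_) hδ
      have hu := IDField.constMarginal_leftVec (P := P) hX t (EuclideanSpace.single j 1)
      have hv := IDField.constMarginal_rightVec hstat hX t (EuclideanSpace.single k 1)
      exact IDField.tendsto_measure_of_crossMoment hT hu hv
        ((hind _ _).tendsto_crossMoment hT hu hv) hε
  · intro h
    exact IDField.isMixing_of_tendsto_twoPointChar hstat hX hID fun t ht a b =>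
      IDField.tendsto_twoPointChar_of_conditions hstat hX hID (h t ht).1 (h t ht).2 a b
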